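/- Let $N\ge 1$, $\Sigma_N=\{-1,+1\}^N$ and $R(\sigma,\tau)=\frac1N\sum_{i\le N}\sigma_i\tau_i$. Let $\xi:\mathbb R\to\mathbb R$ be a smooth convex function with $\xi(0)=\xi'(0)=0$, and let $(H_N(\sigma))_{\sigma\in\Sigma_N}$ be a centred jointly Gaussian family with covariance $\mathbb E H_N(\sigma)H_N(\tau)=N\xi(R(\sigma,\tau))$. Put $\theta(x)=x\xi'(x)-\xi(x)$ and $\Delta(a,b)=\xi(a)-a\xi'(b)+\theta(b)$. Let $k\ge 1$, $0=m_0<m_1<\dots<m_k=1$ and $0=q_0<q_1<\dots<q_k<q_{k+1}=1$. Let $Z=(z_{il})_{1\le i\le N,\,0\le l\le k}$ be a matrix of independent centred Gaussian variables, independent of $H_N$, with $\mathbb E z_{il}^2=\xi'(q_{l+1})-\xi'(q_l)$, and let $s_i=\sum_{0\le l\le k}z_{il}$. For $0\le t\le 1$ let $$H_t(\sigma)=\sqrt t\,H_N(\sigma)+\sqrt{1-t}\,\sum_{i\le N}s_i\sigma_i,\qquad X_k=\log\sum_{\sigma\in\Sigma_N}\exp H_t(\sigma),\qquad X_{l-1}=\frac1{m_l}\log\mathbb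 E_l\exp (m_lX_l)\quad(1\le l\le k),$$ where $\mathbb E_l$ is the expectation in the variables $z_{ip}$, $1\le i\le N$, $l\le p\le k$, only. Let $\varphi(t)=\frac1N\mathbb E X_0$ and $W_l=\exp \bigl(m_l(X_l-X_{l-1})\bigr)$ for $1\le l\le k$. For $1\le r\le k$ let $Z^1,Z^2$ be two copies of $Z$ (jointly independent of $H_N$) whose columns $0,\dots,r-1$ coincide and whose columns $r,\dots,k$ are independent (of each other and of the shared columns), and let $H^j_t,X^j_l,W^j_l$ be defined as above from $Z^j$ (and the same $H_N$), $j=1,2$. For $f:\Sigma_N^2\to\mathbb R$ define $$\mu_r(f)=\mathbb E\Bigl[\prod_{1\le l<r}W^1_l\prod_{r\le l\le k}W^1_lW^2_l\;\langle f\rangle\Bigr],$$ where $\langle\cdot\rangle$ is the Gibbs average on $\Sigma_N^2$ with weights proportional to $\exp\bigl(H^1_t(\sigma^1)+H^2_t(\sigma^2)\bigr)$; $\mu_r$ depends on $t$. Then, for every $t\in[0,1]$, all the expectations above are well defined (the variables $\exp(m_lX_l)$ under $\mathbb E_l$, $X_0$, and the variable defining $\mu_r(f)$ for every $f$ are integrable),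 and $\varphi$ is differentiable on $[0,1]$ (one-sidedly at the endpoints) with $$\varphi'(t)=-\frac12\theta(1)+\frac12\sum_{1\le r\le k}(m_r-m_{r-1})\,\theta(q_r)-\frac12\sum_{1\le r\le k}(m_r-m_{r-1})\,\mu_r\bigl(\Delta(R_{1,2},q_r)\bigr),$$ where $R_{1,2}=R(\sigma^1,\sigma^2)$. -/

import Mathlib

open MeasureTheory ProbabilityTheory

noncomputable section

namespace Guerra

/-- Spin configurations: `Σ_N = {-1, +1}^N` (the units of `ℤ` are `1` and `-1`). -/
abbrev SpinConfig (N : ℕ) : Type := Fin N → ℤˣ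

/-- The value `σ_i ∈ {-1, +1}` of a spin as a real number. -/
def spin {N : ℕ} (σ : SpinConfig N) (i : Fin N) : ℝ := ((σ i : ℤ) : ℝ)

/-- The overlap `R(σ, τ) = N⁻¹ ∑ σ_i τ_i`. -/
def overlap {N : ℕ} (σ τ : SpinConfig N) : ℝ :=
  (∑ i, spin σ i * spin τ i) / N

/-- `θ(x) = x ξ'(x) - ξ(x)`. -/
def theta (ξ : ℝ → ℝ) (x : ℝ) : ℝ := x * deriv ξ x - ξ x

/-- `Δ(a, b) = ξ(a) - a ξ'(b) + θ(b)`. -/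
def Delta (ξ : ℝ → ℝ) (a b : ℝ) : ℝ := ξ a - a * deriv ξ b + theta ξ b

/-- The matrices `Z = (z_{il})`, `1 ≤ i ≤ N`, `0 ≤ l ≤ k`. -/
abbrev Mat (N k : ℕ) : Type := Fin N → Fin (k + 1) → ℝ

/-- The law of `Z`: independent centred Gaussian entries, the entries of column `l` having variance
`ξ'(q_{l+1}) - ξ'(q_l)`. -/
def matLaw (ξ : ℝ → ℝ) (N : ℕ) {k : ℕ} (q : Fin (k + 2) → ℝ) : Measure (Mat N k) :=
  Measure.pi fun _ : Fin N => Measure.pi fun l : Fin (k + 1) =>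
    gaussianReal 0 (Real.toNNReal (deriv ξ (q l.succ) - deriv ξ (q l.castSucc)))

instance (ξ : ℝ → ℝ) (N : ℕ) {k : ℕ} (q : Fin (k + 2) → ℝ) :
    IsProbabilityMeasure (matLaw ξ N q) := by
  unfold matLaw
  infer_instance

/-- The matrix whose columns `p < l` are those of `z` and whose columns `p ≥ l` are those of `z'`. -/
def splice {N k : ℕ} (l : Fin (k + 1)) (z z' : Mat N k) : Mat N k :=
  fun i p => if p < l then z i p else z' i p

/-- `H_t(σ) = √t H_N(σ) + √(1-t) s·σ` with `s_i = ∑_l z_{il}`, where `h` is the realization of the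
Hamiltonian `H_N`. -/
def interpHam {N k : ℕ} (t : ℝ) (h : SpinConfig N → ℝ) (z : Mat N k) (σ : SpinConfig N) : ℝ :=
  Real.sqrt t * h σ + Real.sqrt (1 - t) * ∑ i, (∑ l, z i l) * spin σ i

/-- The random variables `X_l`, `0 ≤ l ≤ k`, as functions of the realizations `h` of `H_N` and `z`
of `Z`: `X_k = log ∑_σ exp H_t(σ)` and `X_{l-1} = m_l⁻¹ log E_l exp (m_l X_l)`, where `E_l` is the
expectation in the columns `p ≥ l` of `Z`. In the recursion, `l : Fin k` stands for the index
`l + 1 ∈ {1, …, k}`. -/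
def X (ξ : ℝ → ℝ) {N k : ℕ} (m : Fin (k + 1) → ℝ) (q : Fin (k + 2) → ℝ) (t : ℝ)
    (h : SpinConfig N → ℝ) (l : Fin (k + 1)) : Mat N k → ℝ :=
  Fin.reverseInduction (motive := fun _ => Mat N k → ℝ)
    (fun z => Real.log (∑ σ, Real.exp (interpHam t h z σ)))
    (fun l Xl z => (1 / m l.succ) *
      Real.log (∫ z', Real.exp (m l.succ * Xl (splice l.succ z z')) ∂(matLaw ξ N q)))
    l

/-- `W_l = exp (m_l (X_l - X_{l-1}))`, `1 ≤ l ≤ k`; the argument `l : Fin k` stands for the index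
`l + 1 ∈ {1, …, k}`. -/
def W (ξ : ℝ → ℝ) {N k : ℕ} (m : Fin (k + 1) → ℝ) (q : Fin (k + 2) → ℝ) (t : ℝ)
    (h : SpinConfig N → ℝ) (l : Fin k) (z : Mat N k) : ℝ :=
  Real.exp (m l.succ * (X ξ m q t h l.succ z - X ξ m q t h l.castSucc z))

/-- The Gibbs average on `Σ_N × Σ_N` with respect to the Hamiltonian
`H_t(σ, τ) = H_t¹(σ) + H_t²(τ)`, where `H_t¹`, `H_t²` are built from `z₁`, `z₂` (and the same `h`). -/
def gibbs {N k : ℕ} (t : ℝ) (h : SpinConfig N → ℝ) (z₁ z₂ : Mat N k)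
    (f : SpinConfig N → SpinConfig N → ℝ) : ℝ :=
  (∑ σ, ∑ τ, f σ τ * Real.exp (interpHam t h z₁ σ + interpHam t h z₂ τ)) /
    ∑ σ, ∑ τ, Real.exp (interpHam t h z₁ σ + interpHam t h z₂ τ)

/-- The random variable `∏_{l < r} W_l¹ ∏_{l ≥ r} W_l¹ W_l² ⟨f⟩` whose expectation is `μ_r(f)`,
for given realizations `h` of `H_N` and `z₁`, `z₂` of the two copies of `Z`; the argument `r : Fin k`
stands for the index `r + 1 ∈ {1, …, k}`. -/
def muIntegrand (ξ : ℝ → ℝ) {N k : ℕ} (m : Fin (k + 1) → ℝ) (q : Fin (k + 2) → ℝ) (t : ℝ)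
    (r : Fin k) (f : SpinConfig N → SpinConfig N → ℝ)
    (h : SpinConfig N → ℝ) (z₁ z₂ : Mat N k) : ℝ :=
  (∏ l ∈ Finset.univ.filter (fun l => l < r), W ξ m q t h l z₁) *
    (∏ l ∈ Finset.univ.filter (fun l => r ≤ l), W ξ m q t h l z₁ * W ξ m q t h l z₂) *
    gibbs t h z₁ z₂ f

/-- `μ_r(f)`: the expectation is over `H_N` and an independent pair of copies `Z¹, Z²` of `Z`
which share the columns `0, …, r - 1` and have independent other columns. Such a pair is
`Z¹ = Z`, `Z² = splice r Z Z'` with `Z, Z'` independent of law `matLaw`. Again the argument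
`r : Fin k` stands for the index `r + 1 ∈ {1, …, k}`. -/
def mu {Ω : Type*} [MeasurableSpace Ω] (P : Measure Ω) (ξ : ℝ → ℝ) {N k : ℕ}
    (H : Ω → SpinConfig N → ℝ) (m : Fin (k + 1) → ℝ) (q : Fin (k + 2) → ℝ) (t : ℝ)
    (r : Fin k) (f : SpinConfig N → SpinConfig N → ℝ) : ℝ :=
  ∫ x : Ω × Mat N k × Mat N k,
    muIntegrand ξ m q t r f (H x.1) x.2.1 (splice r.succ x.2.1 x.2.2)
      ∂(P.prod ((matLaw ξ N q).prod (matLaw ξ N q)))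

/-- Guerra's interpolation `φ(t) = N⁻¹ E X_0`, the expectation being over `H_N` and `Z`, which are
independent. -/
def phi {Ω : Type*} [MeasurableSpace Ω] (P : Measure Ω) (ξ : ℝ → ℝ) {N k : ℕ}
    (H : Ω → SpinConfig N → ℝ) (m : Fin (k + 1) → ℝ) (q : Fin (k + 2) → ℝ) (t : ℝ) : ℝ :=
  (N : ℝ)⁻¹ * ∫ x : Ω × Mat N k, X ξ m q t (H x.1) 0 x.2 ∂(P.prod (matLaw ξ N q))

/-- `H` is a centred Gaussian family indexed by `Σ_N` with covariance
`E H(σ) H(τ) = N ξ(R(σ, τ))`. -/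
structure IsHamiltonian {Ω : Type*} [MeasurableSpace Ω] (P : Measure Ω) (ξ : ℝ → ℝ) {N : ℕ}
    (H : Ω → SpinConfig N → ℝ) : Prop where
  gaussian : HasGaussianLaw H P
  mean : ∀ σ, ∫ ω, H ω σ ∂P = 0
  cov : ∀ σ τ, ∫ ω, H ω σ * H ω τ ∂P = N * ξ (overlap σ τ)

end Guerra

end

/-! Differentiating `X_{l-1} = m_l⁻¹ log E_l exp (m_l X_l)` in a parameter gives `X_{l-1}' = E_l
[W_l X_l']`. Hence the derivative of `E X_0` is the expectation of `∏ W_l ⟨H_t'⟩`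
(`hasDerivAt_nested`, `Admissible.integral_nestedDeriv_zero`). Since `m_0 = 0` and `m_k = 1`,
summation by parts turns `∏ W_l` times the Gibbs weight of `σ` into `exp (H_t(σ) - ∑ (m_r - m_{r-1})
X_{r-1})` (`prod_tilt_mul_gibbs`).

Gaussian integration by parts (`integral_mul_of_isGaussian`) differentiates this exponential. The
term `H_t(σ)` contributes the self-overlap. The derivative of `X_{r-1}`, unrolled
(`Admissible.nestedDeriv_eq_integral`), is an average over a second replica which shares the columns
below `r` and carries the weights `W_l`, `l ≥ r`; this produces `μ_r`. The field `H_N` acts on every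
level with covariance `N ξ(R)`. Column `j` of `Z` acts on `X_{r-1}` only if `j ≤ r - 1`, so the
variances of the columns telescope to `ξ'(q_r)` (`integral_field_mul_totalWeight`,
`integral_column_mul_totalWeight`). The outcome is half of `ξ(1) - ξ'(1) - ∑ (m_r - m_{r-1})
μ_r(ξ(R) - R ξ'(q_r))`, and `μ_r(1) = 1` converts it into the form with `Δ` and `θ`.

The square roots are singular at the endpoints, so the computation runs along the angle `s` with `√t
= sin s`, `√(1 - t) = cos s`, where everything is differentiable on the whole line
(`hasDerivAt_rotation_integral`). The chain rule gives the result for `0 < t < 1`, and continuity of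
`φ` and of the candidate derivative gives the one-sided derivatives at `0` and `1`.

All integrability rests on one bookkeeping device: every `X_l` grows at most affinely in the norms
of the Gaussian data, all weights grow at most exponentially, and Gaussian norms have all
exponential moments. -/

namespace Guerra

/-! ### Gaussian integration by parts, in dimension one and for a linear form on a Banach space. -/

lemma integrable_gaussianReal_iff {v : NNReal} (hv : v ≠ 0) {f : ℝ → ℝ} :
    Integrable f (gaussianReal 0 v) ↔ Integrable (fun x => gaussianPDFReal 0 v x * f x) := by
  rw [gaussianReal_of_var_ne_zero _ hv, integrable_withDensity_iff_integrable_smul'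
    (measurable_gaussianPDF _ _) (Filter.Eventually.of_forall fun x => gaussianPDF_lt_top)]
  simp [toReal_gaussianPDF]

lemma hasDerivAt_gaussianPDFReal {v : NNReal} (x : ℝ) :
    HasDerivAt (gaussianPDFReal 0 v) (-(x / v) * gaussianPDFReal 0 v x) x := by
  unfold gaussianPDFReal
  have h1 : HasDerivAt (fun x : ℝ => -(x - 0) ^ 2 / (2 * (v : ℝ))) (-(x / v)) x := by
    have := (((hasDerivAt_id x).sub_const 0).pow 2).neg.div_const (2 * (v : ℝ))
    refine this.congr_deriv ?_
    rcases eq_or_ne (v : ℝ) 0 with h | h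
    · simp [h]
    · simp only [id]
      field_simp
      simp [mul_comm]
  exact (h1.exp.const_mul (√(2 * Real.pi * v))⁻¹).congr_deriv (by ring)

/-- Gaussian integration by parts in dimension one. -/
lemma integral_mul_gaussianReal {v : NNReal} {f f' : ℝ → ℝ}
    (hf : ∀ x, HasDerivAt f (f' x) x) (hfi : Integrable f (gaussianReal 0 v))
    (hfi' : Integrable f' (gaussianReal 0 v))
    (hxf : Integrable (fun x => x * f x) (gaussianReal 0 v)) :
    ∫ x, x * f x ∂(gaussianReal 0 v) = v * ∫ x, f' x ∂(gaussianReal 0 v) := by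
  rcases eq_or_ne v 0 with rfl | hv
  · simp [gaussianReal_zero_var]
  have hv' : (v : ℝ) ≠ 0 := by exact_mod_cast hv
  rw [integrable_gaussianReal_iff hv] at hfi hfi' hxf
  have hd : ∀ x, HasDerivAt (fun x => gaussianPDFReal 0 v x * f x)
      (gaussianPDFReal 0 v x * f' x - (v : ℝ)⁻¹ * (gaussianPDFReal 0 v x * (x * f x))) x := by
    intro x
    exact ((hasDerivAt_gaussianPDFReal x).mul (hf x)).congr_deriv (by ring)
  -- The density times `f` is integrable with integrable derivative, so that derivative integrates
  -- to zero.
  have h0 := integral_eq_zero_of_hasDerivAt_of_integrable hd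
    (hfi'.sub (hxf.const_mul _)) hfi
  rw [integral_sub hfi' (hxf.const_mul _), integral_const_mul] at h0
  rw [integral_gaussianReal_eq_integral_smul hv, integral_gaussianReal_eq_integral_smul hv]
  simp only [smul_eq_mul]
  rw [sub_eq_zero.mp h0, mul_inv_cancel_left₀ hv']

section

variable {E : Type*} [NormedAddCommGroup E] [NormedSpace ℝ E] [MeasurableSpace E] [BorelSpace E]
  [CompleteSpace E] [SecondCountableTopology E]

/-- Gaussian integration by parts for a centred Gaussian measure: multiplying by a linear form `L`
amounts to differentiating in the direction which represents the covariance with `L`. -/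
lemma integral_mul_of_isGaussian {μ : Measure E} [IsGaussian μ] (L : StrongDual ℝ E)
    (hμ : ∀ L' : StrongDual ℝ E, ∫ x, L' x ∂μ = 0) (c : E)
    (hc : ∀ L' : StrongDual ℝ E, ∫ x, L x * L' x ∂μ = L' c)
    {f f' : E → ℝ} (hfm : Measurable f) (hfm' : Measurable f')
    (hf : ∀ x, HasDerivAt (fun u : ℝ => f (x + u • c)) (f' x) 0)
    (hfi : Integrable f μ) (hfi' : Integrable f' μ) (hLf : Integrable (fun x => L x * f x) μ) :
    ∫ x, L x * f x ∂μ = ∫ x, f' x ∂μ := by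
  have hid : HasGaussianLaw (id : E → E) μ := IsGaussian.hasGaussianLaw_id
  have hL2 : ∀ L' : StrongDual ℝ E, MemLp (fun x => L' x) 2 μ := fun L' =>
    L'.comp_memLp' (IsGaussian.memLp_id μ 2 (by simp))
  set v : ℝ := L c with hvdef
  have hvL : ∫ x, L x * L x ∂μ = v := hc L
  have hv0 : 0 ≤ v := hvL ▸ integral_nonneg fun x => mul_self_nonneg _
  rcases hv0.eq_or_lt with hv | hv
  -- Degenerate case: `L` has variance zero, so it vanishes almost surely. Its covariance with every
  -- linear form is then zero, which forces `c = 0`, and both integrands vanish.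
  · have hLz : ∀ᵐ x ∂μ, L x = 0 := by
      have h := (integral_eq_zero_iff_of_nonneg (fun x => mul_self_nonneg (L x))
        ((hL2 L).integrable_mul (hL2 L))).1 (hvL.trans hv.symm)
      filter_upwards [h] with x hx using by simpa using hx
    have hc0 : c = 0 := by
      refine SeparatingDual.eq_zero_of_forall_dual_eq_zero (R := ℝ) fun L' => ?_
      rw [← hc L', integral_eq_zero_of_ae]
      filter_upwards [hLz] with x hx using by simp [hx]
    have hf0 : ∀ x, f' x = 0 := fun x =>
      (hf x).unique (by simpa [hc0] using hasDerivAt_const (0 : ℝ) (f x))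
    rw [integral_eq_zero_of_ae, integral_eq_zero_of_ae]
    · exact Filter.Eventually.of_forall hf0
    · filter_upwards [hLz] with x hx using by simp [hx]
  have hv' : v ≠ 0 := hv.ne'
  -- Regression on `L`: `x` splits as `T x` plus a multiple of `c`. Since `T c = 0`, every linear
  -- form of `T x` is uncorrelated with `L x`, and by joint Gaussianity `T x` and `L x` are
  -- independent. Fubini then leaves a one-dimensional integration by parts in `L x` with `T x`
  -- frozen.
  set T : E →L[ℝ] E := ContinuousLinearMap.id ℝ E - (v⁻¹ • L).smulRight c with hT
  have hTx : ∀ x, T x + (v⁻¹ * L x) • c = x := by intro x; simp [hT]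
  have hlaw : HasGaussianLaw (fun x => (L x, T x)) μ := hid.map (L.prod T)
  have hind : IndepFun (fun x => L x) (fun x => T x) μ := by
    refine hlaw.indepFun_of_covariance_strongDual fun L₁ L₂ => ?_
    have e1 : ∀ x, L₁ (L x) = L₁ 1 * L x := fun x => by
      conv_lhs => rw [← mul_one (L x), ← smul_eq_mul, map_smul, smul_eq_mul, mul_comm]
    refine (covariance_eq_sub (hL2 (L₁.comp L)) (hL2 (L₂.comp T))).trans ?_
    have e2 : ∫ x, L₁ (L x) * (L₂.comp T) x ∂μ = 0 := by
      simp only [e1, mul_assoc, integral_const_mul, hc (L₂.comp T)]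
      simp [hT, ← hvdef, hv']
    have e3 : ∫ x, L₁ (L x) ∂μ = 0 := hμ (L₁.comp L)
    exact (congrArg₂ (· - ·) e2 (congrArg (· * _) e3)).trans (by simp)
  have hmap : μ.map (fun x => (L x, T x)) = (gaussianReal 0 v.toNNReal).prod (μ.map T) := by
    rw [(indepFun_iff_map_prod_eq_prod_map_map (by fun_prop) (by fun_prop)).1 hind]
    congr 1
    have := (hid.map L).map_eq_gaussianReal
    have hvar : Var[fun x => L x; μ] = v := by
      rw [variance_of_integral_eq_zero (by fun_prop) (hμ L), ← hvL]
      simp [sq]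
    simpa [Function.comp_def, hμ, hvar] using this
  have hprob : IsProbabilityMeasure (μ.map T) := Measure.isProbabilityMeasure_map (by fun_prop)
  set F : ℝ × E → ℝ := fun p => f (p.2 + (v⁻¹ * p.1) • c) with hF
  set F' : ℝ × E → ℝ := fun p => f' (p.2 + (v⁻¹ * p.1) • c) with hF'
  have hmeas : Measurable fun p : ℝ × E => p.2 + (v⁻¹ * p.1) • c := by fun_prop
  have hFm : Measurable F := hfm.comp hmeas
  have hFm' : Measurable F' := hfm'.comp hmeas
  have hLT : AEMeasurable (fun x => (L x, T x)) μ := by fun_prop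
  have hFi : Integrable F ((gaussianReal 0 v.toNNReal).prod (μ.map T)) := by
    rw [← hmap, integrable_map_measure hFm.aestronglyMeasurable hLT]
    simpa [Function.comp_def, hF, hTx] using hfi
  have hFi' : Integrable F' ((gaussianReal 0 v.toNNReal).prod (μ.map T)) := by
    rw [← hmap, integrable_map_measure hFm'.aestronglyMeasurable hLT]
    simpa [Function.comp_def, hF', hTx] using hfi'
  have hxF : Integrable (fun p => p.1 * F p) ((gaussianReal 0 v.toNNReal).prod (μ.map T)) := by
    rw [← hmap, integrable_map_measure (by fun_prop) hLT]
    simpa [Function.comp_def, hF, hTx] using hLf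
  have e1 : ∫ x, L x * f x ∂μ = ∫ p, p.1 * F p ∂((gaussianReal 0 v.toNNReal).prod (μ.map T)) := by
    rw [← hmap, integral_map hLT (by fun_prop)]
    simp [hF, hTx]
  have e2 : ∫ x, f' x ∂μ = ∫ p, F' p ∂((gaussianReal 0 v.toNNReal).prod (μ.map T)) := by
    rw [← hmap, integral_map hLT (by fun_prop)]
    simp [hF', hTx]
  rw [e1, e2, integral_prod_symm _ hxF, integral_prod_symm _ hFi']
  refine integral_congr_ae ?_
  filter_upwards [hFi.prod_left_ae, hFi'.prod_left_ae, hxF.prod_left_ae] with y h1 h2 h3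
  -- The derivative is assumed only at `u = 0`, but at every base point; moving the base point along
  -- `c` gives it on the whole line. The factor `v⁻¹` cancels the variance `v` of the
  -- one-dimensional formula.
  have hder : ∀ s, HasDerivAt (fun s => F (s, y)) (v⁻¹ * F' (s, y)) s := by
    intro s
    have h := hf (y + (v⁻¹ * s) • c)
    have hs : HasDerivAt (fun r : ℝ => v⁻¹ * (r - s)) v⁻¹ s := by
      simpa using ((hasDerivAt_id s).sub_const s).const_mul v⁻¹
    have h' : HasDerivAt (fun u : ℝ => f (y + (v⁻¹ * s) • c + u • c))
        (f' (y + (v⁻¹ * s) • c)) (v⁻¹ * (s - s)) := by simpa using h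
    have := h'.comp s hs
    rw [mul_comm]
    refine this.congr_of_eventuallyEq (Filter.Eventually.of_forall fun r => ?_)
    simp only [hF, Function.comp_apply, add_assoc, ← add_smul]
    congr 3
    ring
  rw [integral_mul_gaussianReal hder h1 (h2.const_mul _) h3, integral_const_mul,
    Real.coe_toNNReal _ hv0, mul_inv_cancel_left₀ hv']

end

end Guerra

/-! ### Growth classes, exponential moments, and the map `f ↦ c⁻¹ log E exp (c f)`. -/

noncomputable section

namespace Guerra

section Growth

variable {α β ι : Type*} {w : α → ℝ} {w' : β → ℝ} {f g : α → ℝ}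

/-- Growth at most affine in the weight `w`. -/
def LinGrowth (w : α → ℝ) (f : α → ℝ) : Prop := ∃ C, 0 ≤ C ∧ ∀ a, |f a| ≤ C * (1 + w a)

/-- Growth at most exponential in the weight `w`. -/
def ExpGrowth (w : α → ℝ) (f : α → ℝ) : Prop := ∃ C, 0 ≤ C ∧ ∀ a, |f a| ≤ Real.exp (C * (1 + w a))

/-- All exponential moments of the weight `w` are finite. -/
def ExpMoments [MeasurableSpace α] (w : α → ℝ) (μ : Measure α) : Prop :=
  ∀ C : ℝ, Integrable (fun a => Real.exp (C * w a)) μ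

lemma LinGrowth.const (hw : ∀ a, 0 ≤ w a) (c : ℝ) : LinGrowth w (fun _ => c) :=
  ⟨|c|, abs_nonneg _, fun a => le_mul_of_one_le_right (abs_nonneg _) (by linarith [hw a])⟩

lemma LinGrowth.self (hw : ∀ a, 0 ≤ w a) : LinGrowth w w :=
  ⟨1, zero_le_one, fun a => by rw [abs_of_nonneg (hw a)]; linarith⟩

lemma LinGrowth.of_le (hf : LinGrowth w f) (h : ∀ a, |g a| ≤ |f a|) : LinGrowth w g :=
  hf.imp fun _ hC => ⟨hC.1, fun a => (h a).trans (hC.2 a)⟩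

lemma LinGrowth.add (hf : LinGrowth w f) (hg : LinGrowth w g) :
    LinGrowth w (fun a => f a + g a) := by
  obtain ⟨C, hC, h⟩ := hf
  obtain ⟨D, hD, h'⟩ := hg
  exact ⟨C + D, add_nonneg hC hD, fun a => (abs_add_le _ _).trans (by linarith [h a, h' a])⟩

lemma LinGrowth.bdd_mul {c : α → ℝ} {b : ℝ} (hc : ∀ a, |c a| ≤ b) (hf : LinGrowth w f) :
    LinGrowth w (fun a => c a * f a) := by
  obtain ⟨C, hC, h⟩ := hf
  refine ⟨|b| * C, by positivity, fun a => ?_⟩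
  rw [abs_mul, mul_assoc]
  exact mul_le_mul ((hc a).trans (le_abs_self _)) (h a) (abs_nonneg _) (abs_nonneg _)

lemma LinGrowth.const_mul (c : ℝ) (hf : LinGrowth w f) : LinGrowth w (fun a => c * f a) :=
  hf.bdd_mul (c := fun _ => c) fun _ => le_rfl

lemma LinGrowth.sub (hf : LinGrowth w f) (hg : LinGrowth w g) :
    LinGrowth w (fun a => f a - g a) := by
  simpa [sub_eq_add_neg] using hf.add (hg.const_mul (-1))

lemma LinGrowth.sum (hw : ∀ a, 0 ≤ w a) {s : Finset ι} {f : ι → α → ℝ}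
    (hf : ∀ i ∈ s, LinGrowth w (f i)) : LinGrowth w (fun a => ∑ i ∈ s, f i a) := by
  classical
  induction s using Finset.induction_on with
  | empty => simpa using LinGrowth.const hw 0
  | insert i s hi ih =>
    simp only [Finset.sum_insert hi]
    exact (hf i (by simp)).add (ih fun j hj => hf j (by simp [hj]))

lemma LinGrowth.comp (hw' : ∀ b, 0 ≤ w' b) (hf : LinGrowth w f) {φ : β → α}
    (hφ : LinGrowth w' (fun b => w (φ b))) : LinGrowth w' (fun b => f (φ b)) := by
  obtain ⟨C, hC, h⟩ := hf
  obtain ⟨D, hD, h'⟩ := hφ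
  refine ⟨C * (1 + D), by positivity, fun b => (h _).trans ?_⟩
  rw [mul_assoc]
  refine mul_le_mul_of_nonneg_left ?_ hC
  linarith [le_abs_self (w (φ b)), h' b, hw' b]

lemma LinGrowth.exp (hf : LinGrowth w f) : ExpGrowth w (fun a => Real.exp (f a)) :=
  hf.imp fun C hC => ⟨hC.1, fun a => by
    rw [Real.abs_exp]
    exact Real.exp_le_exp.2 ((le_abs_self _).trans (hC.2 a))⟩

lemma LinGrowth.expGrowth (hf : LinGrowth w f) : ExpGrowth w f :=
  hf.imp fun C hC => ⟨hC.1, fun a => (hC.2 a).trans (by linarith [Real.add_one_le_exp (C * (1 + w a))])⟩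

lemma ExpGrowth.of_le (hf : ExpGrowth w f) (h : ∀ a, |g a| ≤ |f a|) : ExpGrowth w g :=
  hf.imp fun _ hC => ⟨hC.1, fun a => (h a).trans (hC.2 a)⟩

lemma ExpGrowth.const (hw : ∀ a, 0 ≤ w a) (c : ℝ) : ExpGrowth w (fun _ => c) :=
  (LinGrowth.const hw c).expGrowth

lemma ExpGrowth.mul (hf : ExpGrowth w f) (hg : ExpGrowth w g) :
    ExpGrowth w (fun a => f a * g a) := by
  obtain ⟨C, hC, h⟩ := hf
  obtain ⟨D, hD, h'⟩ := hg
  refine ⟨C + D, add_nonneg hC hD, fun a => ?_⟩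
  rw [abs_mul, add_mul, Real.exp_add]
  exact mul_le_mul (h a) (h' a) (abs_nonneg _) (Real.exp_pos _).le

lemma ExpGrowth.add (hw : ∀ a, 0 ≤ w a) (hf : ExpGrowth w f) (hg : ExpGrowth w g) :
    ExpGrowth w (fun a => f a + g a) := by
  obtain ⟨C, hC, h⟩ := hf
  obtain ⟨D, hD, h'⟩ := hg
  -- The extra `1` in the exponent absorbs the factor `2` of the sum of two exponentials, because
  -- `exp (1 + w) ≥ 2`.
  refine ⟨C + D + 1, by positivity, fun a => (abs_add_le _ _).trans ?_⟩
  have hW : 1 ≤ 1 + w a := by linarith [hw a]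
  have e1 : |f a| ≤ Real.exp ((C + D) * (1 + w a)) :=
    (h a).trans (Real.exp_le_exp.2 (by nlinarith))
  have e2 : |g a| ≤ Real.exp ((C + D) * (1 + w a)) :=
    (h' a).trans (Real.exp_le_exp.2 (by nlinarith))
  have e3 : 2 ≤ Real.exp (1 * (1 + w a)) := by linarith [Real.add_one_le_exp (1 * (1 + w a))]
  rw [add_mul _ 1, Real.exp_add]
  nlinarith [Real.exp_pos ((C + D) * (1 + w a))]

lemma ExpGrowth.sum (hw : ∀ a, 0 ≤ w a) {s : Finset ι} {f : ι → α → ℝ}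
    (hf : ∀ i ∈ s, ExpGrowth w (f i)) : ExpGrowth w (fun a => ∑ i ∈ s, f i a) := by
  classical
  induction s using Finset.induction_on with
  | empty => simpa using ExpGrowth.const hw 0
  | insert i s hi ih =>
    simp only [Finset.sum_insert hi]
    exact (hf i (by simp)).add hw (ih fun j hj => hf j (by simp [hj]))

lemma ExpGrowth.prod (hw : ∀ a, 0 ≤ w a) {s : Finset ι} {f : ι → α → ℝ}
    (hf : ∀ i ∈ s, ExpGrowth w (f i)) : ExpGrowth w (fun a => ∏ i ∈ s, f i a) := by
  classical
  induction s using Finset.induction_on with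
  | empty => simpa using ExpGrowth.const hw 1
  | insert i s hi ih =>
    simp only [Finset.prod_insert hi]
    exact (hf i (by simp)).mul (ih fun j hj => hf j (by simp [hj]))

lemma ExpGrowth.comp (hw' : ∀ b, 0 ≤ w' b) (hf : ExpGrowth w f) {φ : β → α}
    (hφ : LinGrowth w' (fun b => w (φ b))) : ExpGrowth w' (fun b => f (φ b)) := by
  obtain ⟨C, hC, h⟩ := hf
  obtain ⟨D, hD, h'⟩ := hφ
  refine ⟨C * (1 + D), by positivity, fun b => (h _).trans (Real.exp_le_exp.2 ?_)⟩
  rw [mul_assoc]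
  refine mul_le_mul_of_nonneg_left ?_ hC
  linarith [le_abs_self (w (φ b)), h' b, hw' b]

variable [MeasurableSpace α] [MeasurableSpace β] {μ : Measure α} {ν : Measure β}

lemma ExpGrowth.integrable (hf : ExpGrowth w f) (hfm : AEStronglyMeasurable f μ)
    (hμ : ExpMoments w μ) : Integrable f μ := by
  obtain ⟨C, -, h⟩ := hf
  refine ((hμ C).const_mul (Real.exp C)).mono' hfm (Filter.Eventually.of_forall fun a => ?_)
  rw [Real.norm_eq_abs, ← Real.exp_add]
  exact (h a).trans_eq (by ring_nf)

lemma ExpMoments.prod [SFinite μ] [SFinite ν] (hμ : ExpMoments w μ) (hν : ExpMoments w' ν) :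
    ExpMoments (fun p : α × β => w p.1 + w' p.2) (μ.prod ν) := fun C => by
  simpa only [mul_add, Real.exp_add] using (hμ C).mul_prod (hν C)

end Growth

section LogMoment

variable {α β : Type*} {w : α → ℝ} {w' : β → ℝ} [MeasurableSpace β] {ν : Measure β}

lemma ExpGrowth.integral (hw : ∀ a, 0 ≤ w a) (hν : ExpMoments w' ν) {f : α × β → ℝ}
    (hf : ExpGrowth (fun p : α × β => w p.1 + w' p.2) f) :
    ExpGrowth w (fun a => ∫ b, f (a, b) ∂ν) := by
  obtain ⟨C, hC, h⟩ := hf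
  refine ((LinGrowth.self hw).const_mul C).exp.mul
    (ExpGrowth.const hw (Real.exp C * ∫ b, Real.exp (C * w' b) ∂ν)) |>.of_le fun a => ?_
  have hi := ((hν C).const_mul (Real.exp (C * w a) * Real.exp C))
  have : ‖∫ b, f (a, b) ∂ν‖ ≤ ∫ b, Real.exp (C * w a) * Real.exp C * Real.exp (C * w' b) ∂ν := by
    refine norm_integral_le_of_norm_le hi (Filter.Eventually.of_forall fun b => ?_)
    rw [Real.norm_eq_abs, ← Real.exp_add, ← Real.exp_add]
    exact (h (a, b)).trans_eq (by ring_nf)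
  rw [integral_const_mul, mul_assoc] at this
  exact this.trans (le_abs_self _)

lemma ExpGrowth.integrable_section (hw' : ∀ b, 0 ≤ w' b) (hν : ExpMoments w' ν) {f : α × β → ℝ}
    (hf : ExpGrowth (fun p : α × β => w p.1 + w' p.2) f) (a : α)
    (hfm : Measurable fun b => f (a, b)) : Integrable (fun b => f (a, b)) ν :=
  (hf.comp hw' (φ := fun b => (a, b))
    (((LinGrowth.const hw' (w a)).add (LinGrowth.self hw')))).integrable hfm.aestronglyMeasurable hν

/-- The two-sided affine bound on `f` sandwiches the exponential moment between two exponentials in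
`w a`, with prefactors `B₂` and `B₁` that do not depend on `a`; the logarithm is affine again. This
makes affine growth pass through one step of the recursion for `X_l`. The lower bound uses the
exponential moment with negative exponent. -/
lemma LinGrowth.log_integral_exp [IsProbabilityMeasure ν] (hw : ∀ a, 0 ≤ w a) (hν : ExpMoments w' ν) {f : α × β → ℝ}
    (hf : LinGrowth (fun p : α × β => w p.1 + w' p.2) f)
    (hfm : ∀ a, Measurable fun b => f (a, b)) {c : ℝ} (hc : 0 < c) :
    LinGrowth w (fun a => (1 / c) * Real.log (∫ b, Real.exp (c * f (a, b)) ∂ν)) := by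
  obtain ⟨C, hC, h⟩ := hf
  refine LinGrowth.const_mul _ ?_
  set B₁ := ∫ b, Real.exp (c * C * w' b) ∂ν with hB₁
  set B₂ := ∫ b, Real.exp (-(c * C) * w' b) ∂ν with hB₂
  have hp₁ : 0 < B₁ := integral_exp_pos (hν _)
  have hp₂ : 0 < B₂ := integral_exp_pos (hν _)
  refine ⟨c * C + |Real.log B₁| + |Real.log B₂|, by positivity, fun a => ?_⟩
  have hup : ∀ b, Real.exp (c * f (a, b)) ≤
      Real.exp (c * C * (1 + w a)) * Real.exp (c * C * w' b) := fun b => by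
    rw [← Real.exp_add]
    refine Real.exp_le_exp.2 ?_
    have := mul_le_mul_of_nonneg_left ((le_abs_self _).trans (h (a, b))) hc.le
    linarith
  have hlo : ∀ b, Real.exp (-(c * C) * (1 + w a)) * Real.exp (-(c * C) * w' b) ≤
      Real.exp (c * f (a, b)) := fun b => by
    rw [← Real.exp_add]
    refine Real.exp_le_exp.2 ?_
    have := mul_le_mul_of_nonneg_left ((neg_le_abs _).trans (h (a, b))) hc.le
    linarith
  have hi : Integrable (fun b => Real.exp (c * f (a, b))) ν :=
    ((hν (c * C)).const_mul _).mono' ((hfm a).const_mul c).exp.aestronglyMeasurable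
      (Filter.Eventually.of_forall fun b => by simpa using hup b)
  have h1 := integral_mono hi ((hν (c * C)).const_mul _) hup
  have h2 := integral_mono ((hν (-(c * C))).const_mul _) hi hlo
  rw [integral_const_mul] at h1 h2
  have hpos : 0 < ∫ b, Real.exp (c * f (a, b)) ∂ν := integral_exp_pos hi
  have l1 := Real.log_le_log hpos h1
  have l2 := Real.log_le_log (by positivity) h2
  rw [Real.log_mul (by positivity) (by positivity), Real.log_exp] at l1 l2
  have hW := hw a
  have a1 := le_abs_self (Real.log B₁)
  have a2 := neg_le_abs (Real.log B₂)
  have n1 := mul_nonneg (abs_nonneg (Real.log B₁)) hW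
  have n2 := mul_nonneg (abs_nonneg (Real.log B₂)) hW
  have p1 := abs_nonneg (Real.log B₁)
  have p2 := abs_nonneg (Real.log B₂)
  rw [abs_le]
  constructor <;> nlinarith

/-- Differentiation of `c⁻¹ log E exp (c F)` with respect to a parameter. -/
lemma hasDerivAt_log_integral_exp [IsProbabilityMeasure ν] (hw' : ∀ b, 0 ≤ w' b) (hν : ExpMoments w' ν) {F F' : ℝ → β → ℝ}
    (hF : LinGrowth (fun p : ℝ × β => |p.1| + w' p.2) (fun p => F p.1 p.2))
    (hF' : ExpGrowth (fun p : ℝ × β => |p.1| + w' p.2) (fun p => F' p.1 p.2))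
    (hFm : ∀ u, Measurable (F u)) (hFm' : ∀ u, Measurable (F' u))
    (hd : ∀ u b, HasDerivAt (fun u => F u b) (F' u b) u) {c : ℝ} (hc : 0 < c) (u : ℝ) :
    HasDerivAt (fun u => (1 / c) * Real.log (∫ b, Real.exp (c * F u b) ∂ν))
      (∫ b, Real.exp (c * (F u b - (1 / c) * Real.log (∫ b, Real.exp (c * F u b) ∂ν))) * F' u b ∂ν)
      u := by
  have hw0 : ∀ p : ℝ × β, 0 ≤ |p.1| + w' p.2 := fun p => add_nonneg (abs_nonneg _) (hw' _)
  have hE : ExpGrowth (fun p : ℝ × β => |p.1| + w' p.2)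
      (fun p => Real.exp (c * F p.1 p.2) * (c * F' p.1 p.2)) :=
    (hF.const_mul c).exp.mul ((ExpGrowth.const hw0 c).mul hF')
  have hsec : ∀ u : ℝ, LinGrowth w' (fun b => |u| + w' b) := fun u =>
    (LinGrowth.const hw' _).add (LinGrowth.self hw')
  have hint : ∀ u, Integrable (fun b => Real.exp (c * F u b)) ν := fun u =>
    ((hF.const_mul c).exp.comp hw' (φ := fun b => (u, b)) (hsec u)).integrable
      ((hFm u).const_mul c).exp.aestronglyMeasurable hν
  have hpos : ∀ u, 0 < ∫ b, Real.exp (c * F u b) ∂ν := fun u => integral_exp_pos (hint u)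
  obtain ⟨C, hC, hb⟩ := hE
  have hI : HasDerivAt (fun u => ∫ b, Real.exp (c * F u b) ∂ν)
      (∫ b, Real.exp (c * F u b) * (c * F' u b) ∂ν) u := by
    -- On the unit ball around `u` one has `1 + |x| ≤ 2 + |u|`, whence the constant in the
    -- dominating function.
    refine (hasDerivAt_integral_of_dominated_loc_of_deriv_le (Metric.ball_mem_nhds u one_pos)
      (bound := fun b => Real.exp (C * (2 + |u|)) * Real.exp (C * w' b))
      (Filter.Eventually.of_forall fun u => (hint u).aestronglyMeasurable) (hint u)
      (F' := fun u b => Real.exp (c * F u b) * (c * F' u b))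
      ((((hFm u).const_mul c).exp.mul ((hFm' u).const_mul c)).aestronglyMeasurable)
      (Filter.Eventually.of_forall fun b x hx => ?_) ((hν C).const_mul _)
      (Filter.Eventually.of_forall fun b x _ => ((hd x b).const_mul c).exp)).2
    have hx' : |x| ≤ 1 + |u| := by
      rw [Metric.mem_ball, Real.dist_eq] at hx
      linarith [abs_sub_abs_le_abs_sub x u]
    rw [Real.norm_eq_abs, ← Real.exp_add]
    refine (hb (x, b)).trans (Real.exp_le_exp.2 ?_)
    have := mul_le_mul_of_nonneg_left hx' hC
    simp only
    linarith
  refine ((hI.log (hpos u).ne').const_mul (1 / c)).congr_deriv ?_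
  have e : ∀ b, Real.exp (c * (F u b - (1 / c) * Real.log (∫ b, Real.exp (c * F u b) ∂ν))) * F' u b
      = (1 / c) * (∫ b, Real.exp (c * F u b) ∂ν)⁻¹ * (Real.exp (c * F u b) * (c * F' u b)) := by
    intro b
    rw [mul_sub, ← mul_assoc, mul_one_div_cancel hc.ne', one_mul, Real.exp_sub,
      Real.exp_log (hpos u)]
    field_simp
  simp_rw [e]
  rw [integral_const_mul]
  ring

end LogMoment

end Guerra

end

/-! ### Splicing of matrices, the recursion for a general Hamiltonian, and its derivative. -/

noncomputable section

namespace Guerra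

section Splice

variable {N k : ℕ}

lemma norm_splice_le (r : Fin (k + 1)) (z z' : Mat N k) : ‖splice r z z'‖ ≤ ‖z‖ + ‖z'‖ := by
  have h0 := add_nonneg (norm_nonneg z) (norm_nonneg z')
  rw [pi_norm_le_iff_of_nonneg h0]
  intro i
  rw [pi_norm_le_iff_of_nonneg h0]
  intro p
  have h1 : ‖z i p‖ ≤ ‖z‖ := (norm_le_pi_norm (z i) p).trans (norm_le_pi_norm z i)
  have h2 : ‖z' i p‖ ≤ ‖z'‖ := (norm_le_pi_norm (z' i) p).trans (norm_le_pi_norm z' i)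
  unfold splice
  split_ifs
  · linarith [norm_nonneg z']
  · linarith [norm_nonneg z]

lemma measurable_splice (r : Fin (k + 1)) :
    Measurable fun p : Mat N k × Mat N k => splice r p.1 p.2 := by
  refine measurable_pi_iff.2 fun i => measurable_pi_iff.2 fun p => ?_
  unfold splice
  split_ifs <;> fun_prop

lemma splice_splice {r r' : Fin (k + 1)} (h : r ≤ r') (z z' z'' : Mat N k) :
    splice r' (splice r z z') z'' = splice r z (splice r' z' z'') := by
  ext i p
  unfold splice
  by_cases h1 : p < r
  · simp [h1, h1.trans_le h]
  · simp [h1]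

lemma splice_congr_left {r : Fin (k + 1)} {z z' : Mat N k} (h : ∀ i p, p < r → z i p = z' i p)
    (z'' : Mat N k) : splice r z z'' = splice r z' z'' := by
  ext i p
  unfold splice
  split_ifs with hp
  · exact h i p hp
  · rfl

lemma splice_apply_of_lt {r p : Fin (k + 1)} (hp : p < r) (z z' : Mat N k) (i : Fin N) :
    splice r z z' i p = z i p := by simp [splice, hp]

/-- A law of matrices with exponential moments under which two independent samples may be spliced
without changing the law. -/
structure SpliceInvariant (M : Measure (Mat N k)) : Prop where
  moments : ExpMoments (fun z => ‖z‖) M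
  splice : ∀ r, MeasurePreserving (fun p : Mat N k × Mat N k => splice r p.1 p.2) (M.prod M) M

end Splice

section Nested

variable {N k : ℕ} {S : Type*} [Fintype S]

/-- The recursion `X_{l-1} = m_l⁻¹ log E_l exp (m_l X_l)` for a general Hamiltonian. -/
def nested (M : Measure (Mat N k)) (m : Fin (k + 1) → ℝ) (K : S → Mat N k → ℝ)
    (l : Fin (k + 1)) : Mat N k → ℝ :=
  Fin.reverseInduction (motive := fun _ => Mat N k → ℝ)
    (fun z => Real.log (∑ σ, Real.exp (K σ z)))
    (fun l Xl z => (1 / m l.succ) *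
      Real.log (∫ z', Real.exp (m l.succ * Xl (splice l.succ z z')) ∂M))
    l

/-- The Gibbs average of `d` for the Hamiltonian `K`. -/
def gibbsAvg (K d : S → Mat N k → ℝ) (z : Mat N k) : ℝ :=
  (∑ σ, d σ z * Real.exp (K σ z)) / ∑ σ, Real.exp (K σ z)

/-- The derivative of `nested` when the Hamiltonian `K` moves in the direction `d`. -/
def nestedDeriv (M : Measure (Mat N k)) (m : Fin (k + 1) → ℝ) (K d : S → Mat N k → ℝ)
    (l : Fin (k + 1)) : Mat N k → ℝ :=
  Fin.reverseInduction (motive := fun _ => Mat N k → ℝ) (gibbsAvg K d)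
    (fun l Dl z => ∫ z', Real.exp (m l.succ *
      (nested M m K l.succ (splice l.succ z z') - nested M m K l.castSucc z)) *
        Dl (splice l.succ z z') ∂M)
    l

/-- The weights `exp (m_l (X_l - X_{l-1}))`. -/
def tilt (M : Measure (Mat N k)) (m : Fin (k + 1) → ℝ) (K : S → Mat N k → ℝ) (l : Fin k)
    (z : Mat N k) : ℝ :=
  Real.exp (m l.succ * (nested M m K l.succ z - nested M m K l.castSucc z))

variable (M : Measure (Mat N k)) (m : Fin (k + 1) → ℝ)

lemma nested_last (K : S → Mat N k → ℝ) :
    nested M m K (Fin.last k) = fun z => Real.log (∑ σ, Real.exp (K σ z)) :=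
  Fin.reverseInduction_last

lemma nested_castSucc (K : S → Mat N k → ℝ) (l : Fin k) :
    nested M m K l.castSucc = fun z => (1 / m l.succ) *
      Real.log (∫ z', Real.exp (m l.succ * nested M m K l.succ (splice l.succ z z')) ∂M) :=
  Fin.reverseInduction_castSucc _

lemma nestedDeriv_last (K d : S → Mat N k → ℝ) :
    nestedDeriv M m K d (Fin.last k) = gibbsAvg K d :=
  Fin.reverseInduction_last

lemma nestedDeriv_castSucc (K d : S → Mat N k → ℝ) (l : Fin k) :
    nestedDeriv M m K d l.castSucc = fun z => ∫ z', Real.exp (m l.succ *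
      (nested M m K l.succ (splice l.succ z z') - nested M m K l.castSucc z)) *
        nestedDeriv M m K d l.succ (splice l.succ z z') ∂M :=
  Fin.reverseInduction_castSucc _

/-- `X_l` depends only on the columns up to `l`. -/
lemma nested_castSucc_congr (K : S → Mat N k → ℝ) (l : Fin k) {z z' : Mat N k}
    (h : ∀ i p, p < l.succ → z i p = z' i p) :
    nested M m K l.castSucc z = nested M m K l.castSucc z' := by
  simp only [nested_castSucc, splice_congr_left h]

lemma nested_castSucc_splice (K : S → Mat N k → ℝ) {l : Fin k} {r : Fin (k + 1)}
    (h : l.succ ≤ r) (z z' : Mat N k) :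
    nested M m K l.castSucc (splice r z z') = nested M m K l.castSucc z :=
  nested_castSucc_congr M m K l fun i _ hp => splice_apply_of_lt (hp.trans_le h) z z' i

/-- A translation of the columns up to `l` may be absorbed in the Hamiltonian. -/
lemma nested_add (K : S → Mat N k → ℝ) (e : Mat N k) (l : Fin (k + 1))
    (he : ∀ i p, l < p → e i p = 0) (z : Mat N k) :
    nested M m K l (z + e) = nested M m (fun σ z => K σ (z + e)) l z := by
  induction l using Fin.reverseInduction generalizing z with
  | last => simp [nested_last]
  | cast l ih =>
    have hs : ∀ z', splice l.succ (z + e) z' = splice l.succ z z' + e := fun z' => by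
      ext i p
      by_cases hp : p < l.succ
      · simp [splice, hp]
      -- The resampled columns are exactly those in which `e` vanishes, so the translation commutes
      -- with splicing.
      · have : e i p = 0 := he i p (lt_of_lt_of_le Fin.castSucc_lt_succ (not_lt.1 hp))
        simp [splice, hp, this]
    simp only [nested_castSucc, hs]
    congr 2
    refine integral_congr_ae (Filter.Eventually.of_forall fun z' => ?_)
    simp only
    rw [ih fun i p hp => he i p (Fin.castSucc_lt_succ.trans hp)]

/-- Families of Hamiltonians with affine growth. -/
structure Admissible {Θ : Type*} [MeasurableSpace Θ] (ρ : Θ → ℝ) (K : Θ → S → Mat N k → ℝ) :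
    Prop where
  nonneg : ∀ θ, 0 ≤ ρ θ
  meas : ∀ σ, Measurable fun p : Θ × Mat N k => K p.1 σ p.2
  growth : ∀ σ, LinGrowth (fun p : Θ × Mat N k => ρ p.1 + ‖p.2‖) fun p => K p.1 σ p.2

variable {M m} {Θ : Type*} [MeasurableSpace Θ] {ρ : Θ → ℝ} {K d : Θ → S → Mat N k → ℝ}

omit [Fintype S] in
lemma Admissible.nonneg_prod (hK : Admissible ρ K) (p : Θ × Mat N k) : 0 ≤ ρ p.1 + ‖p.2‖ :=
  add_nonneg (hK.nonneg _) (norm_nonneg _)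

omit [Fintype S] in
lemma Admissible.comp {Θ' : Type*} [MeasurableSpace Θ'] {ρ' : Θ' → ℝ} (hρ' : ∀ θ, 0 ≤ ρ' θ)
    (hK : Admissible ρ K) {g : Θ' → Θ} (hg : Measurable g) (h : LinGrowth ρ' fun θ => ρ (g θ)) :
    Admissible ρ' fun θ => K (g θ) where
  nonneg := hρ'
  meas σ := (hK.meas σ).comp ((hg.comp measurable_fst).prodMk measurable_snd)
  growth σ := by
    have hw : ∀ p : Θ' × Mat N k, 0 ≤ ρ' p.1 + ‖p.2‖ := fun p =>
      add_nonneg (hρ' _) (norm_nonneg _)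
    refine (hK.growth σ).comp hw (φ := fun p => (g p.1, p.2)) (.add ?_ ?_)
    · refine h.comp hw (φ := Prod.fst) ((LinGrowth.self hw).of_le fun p => ?_)
      rw [abs_of_nonneg (hρ' _), abs_of_nonneg (hw p)]
      linarith [norm_nonneg p.2]
    · refine (LinGrowth.self hw).of_le fun p => ?_
      rw [abs_of_nonneg (norm_nonneg _), abs_of_nonneg (hw p)]
      linarith [hρ' p.1]

omit [MeasurableSpace Θ] in
lemma linGrowth_splice_weight (hρ : ∀ θ, 0 ≤ ρ θ) (r : Fin (k + 1)) :
    LinGrowth (fun p : (Θ × Mat N k) × Mat N k => ρ p.1.1 + ‖p.1.2‖ + ‖p.2‖)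
      (fun p => ρ p.1.1 + ‖splice r p.1.2 p.2‖) := by
  have hw : ∀ p : (Θ × Mat N k) × Mat N k, 0 ≤ ρ p.1.1 + ‖p.1.2‖ + ‖p.2‖ := fun p => by
    have := hρ p.1.1
    positivity
  refine (LinGrowth.self hw).of_le fun p => ?_
  rw [abs_of_nonneg (add_nonneg (hρ _) (norm_nonneg _)), abs_of_nonneg (hw p), add_assoc]
  exact add_le_add_right (norm_splice_le r _ _) _

lemma measurable_splice_param (r : Fin (k + 1)) :
    Measurable fun p : (Θ × Mat N k) × Mat N k => (p.1.1, splice r p.1.2 p.2) :=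
  (measurable_fst.comp measurable_fst).prodMk
    ((measurable_splice r).comp ((measurable_snd.comp measurable_fst).prodMk measurable_snd))

variable [IsProbabilityMeasure M]

lemma Admissible.measurable_nested (hK : Admissible ρ K) (l : Fin (k + 1)) :
    Measurable fun p : Θ × Mat N k => nested M m (K p.1) l p.2 := by
  induction l using Fin.reverseInduction with
  | last =>
    simp only [nested_last]
    exact (Finset.measurable_sum _ fun σ _ => (hK.meas σ).exp).log
  | cast l ih =>
    simp only [nested_castSucc]
    refine Measurable.const_mul (Measurable.log ?_) _
    exact (StronglyMeasurable.integral_prod_right'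
      (f := fun p : (Θ × Mat N k) × Mat N k =>
        Real.exp (m l.succ * nested M m (K p.1.1) l.succ (splice l.succ p.1.2 p.2)))
      ((ih.comp (measurable_splice_param l.succ)).const_mul _).exp.stronglyMeasurable).measurable

lemma abs_log_sum_exp_le [Nonempty S] (x : S → ℝ) :
    |Real.log (∑ σ, Real.exp (x σ))| ≤ Real.log (Fintype.card S) + ∑ σ, |x σ| := by
  have hc : (1 : ℝ) ≤ Fintype.card S := by exact_mod_cast Fintype.card_pos
  have hx : ∀ σ, |x σ| ≤ ∑ σ, |x σ| := fun σ =>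
    Finset.single_le_sum (f := fun σ => |x σ|) (fun _ _ => abs_nonneg _) (Finset.mem_univ σ)
  have hpos : 0 < ∑ σ, Real.exp (x σ) :=
    Finset.sum_pos (fun _ _ => Real.exp_pos _) Finset.univ_nonempty
  rw [abs_le]
  constructor
  · obtain ⟨σ₀⟩ := ‹Nonempty S›
    have h1 : Real.exp (x σ₀) ≤ ∑ σ, Real.exp (x σ) :=
      Finset.single_le_sum (f := fun σ => Real.exp (x σ)) (fun _ _ => (Real.exp_pos _).le)
        (Finset.mem_univ σ₀)
    have h2 := Real.log_le_log (Real.exp_pos _) h1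
    rw [Real.log_exp] at h2
    linarith [Real.log_nonneg hc, hx σ₀, neg_abs_le (x σ₀)]
  · have h1 : ∑ σ, Real.exp (x σ) ≤ Fintype.card S * Real.exp (∑ σ, |x σ|) := by
      refine (Finset.sum_le_card_nsmul Finset.univ _ (Real.exp (∑ σ, |x σ|)) fun σ _ =>
        Real.exp_le_exp.2 ((le_abs_self _).trans (hx σ))).trans_eq ?_
      simp
    have h2 := Real.log_le_log hpos h1
    rwa [Real.log_mul (by positivity) (Real.exp_pos _).ne', Real.log_exp] at h2

variable [Nonempty S]

lemma Admissible.linGrowth_nested (hK : Admissible ρ K) (hM : SpliceInvariant M)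
    (hm : ∀ l : Fin k, 0 < m l.succ) (l : Fin (k + 1)) :
    LinGrowth (fun p : Θ × Mat N k => ρ p.1 + ‖p.2‖) fun p => nested M m (K p.1) l p.2 := by
  induction l using Fin.reverseInduction with
  | last =>
    simp only [nested_last]
    refine ((LinGrowth.const hK.nonneg_prod (Real.log (Fintype.card S))).add
      (LinGrowth.sum hK.nonneg_prod (s := Finset.univ) fun σ _ =>
        (hK.growth σ).of_le (g := fun p => |K p.1 σ p.2|) fun p => by simp)).of_le fun p => ?_
    exact (abs_log_sum_exp_le _).trans (le_abs_self _)
  | cast l ih =>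
    simp only [nested_castSucc]
    refine LinGrowth.log_integral_exp hK.nonneg_prod hM.moments
      (f := fun p : (Θ × Mat N k) × Mat N k =>
        nested M m (K p.1.1) l.succ (splice l.succ p.1.2 p.2))
      (ih.comp (φ := fun p : (Θ × Mat N k) × Mat N k => (p.1.1, splice l.succ p.1.2 p.2))
        (fun p => add_nonneg (hK.nonneg_prod p.1) (norm_nonneg _))
        (linGrowth_splice_weight hK.nonneg l.succ)) (fun p => ?_) (hm l)
    exact ((hK.measurable_nested l.succ).comp (measurable_splice_param l.succ)).comp
      measurable_prodMk_left

lemma abs_gibbs_le (K : S → Mat N k → ℝ) (σ : S) (z : Mat N k) :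
    |Real.exp (K σ z) / ∑ τ, Real.exp (K τ z)| ≤ 1 := by
  have hpos : 0 < ∑ σ, Real.exp (K σ z) :=
    Finset.sum_pos (fun _ _ => Real.exp_pos _) Finset.univ_nonempty
  rw [abs_of_nonneg (by positivity), div_le_one hpos]
  exact Finset.single_le_sum (f := fun σ => Real.exp (K σ z)) (fun _ _ => (Real.exp_pos _).le)
        (Finset.mem_univ σ)

omit [Nonempty S] in
lemma gibbsAvg_eq_sum (K d : S → Mat N k → ℝ) (z : Mat N k) :
    gibbsAvg K d z = ∑ σ, Real.exp (K σ z) / (∑ τ, Real.exp (K τ z)) * d σ z := by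
  rw [gibbsAvg, Finset.sum_div]
  exact Finset.sum_congr rfl fun σ _ => by ring

omit [Nonempty S] in
lemma Admissible.measurable_gibbsAvg (hK : Admissible ρ K) (hd : Admissible ρ d) :
    Measurable fun p : Θ × Mat N k => gibbsAvg (K p.1) (d p.1) p.2 :=
  (Finset.measurable_sum _ fun σ _ => (hd.meas σ).mul (hK.meas σ).exp).div
    (Finset.measurable_sum _ fun σ _ => (hK.meas σ).exp)

lemma Admissible.linGrowth_gibbsAvg (hd : Admissible ρ d) (K : Θ → S → Mat N k → ℝ) :
    LinGrowth (fun p : Θ × Mat N k => ρ p.1 + ‖p.2‖) fun p => gibbsAvg (K p.1) (d p.1) p.2 := by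
  simp only [gibbsAvg_eq_sum]
  exact LinGrowth.sum hd.nonneg_prod fun σ _ =>
    (hd.growth σ).bdd_mul (c := fun p => Real.exp (K p.1 σ p.2) / ∑ τ, Real.exp (K p.1 τ p.2))
      (b := 1) fun p => abs_gibbs_le _ _ _

lemma Admissible.expGrowth_nestedDeriv_aux (hK : Admissible ρ K) (hM : SpliceInvariant M)
    (hm : ∀ l : Fin k, 0 < m l.succ) (l : Fin k) {D : Θ × Mat N k → ℝ}
    (hD : ExpGrowth (fun p : Θ × Mat N k => ρ p.1 + ‖p.2‖) D) :
    ExpGrowth (fun p : (Θ × Mat N k) × Mat N k => ρ p.1.1 + ‖p.1.2‖ + ‖p.2‖)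
      (fun p => Real.exp (m l.succ * (nested M m (K p.1.1) l.succ (splice l.succ p.1.2 p.2) -
        nested M m (K p.1.1) l.castSucc p.1.2)) * D (p.1.1, splice l.succ p.1.2 p.2)) := by
  have hw : ∀ p : (Θ × Mat N k) × Mat N k, 0 ≤ ρ p.1.1 + ‖p.1.2‖ + ‖p.2‖ := fun p =>
    add_nonneg (hK.nonneg_prod p.1) (norm_nonneg _)
  have hs := linGrowth_splice_weight (N := N) hK.nonneg l.succ
  refine (LinGrowth.exp (LinGrowth.const_mul _ (LinGrowth.sub ?_ ?_))).mul (hD.comp hw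
    (φ := fun p : (Θ × Mat N k) × Mat N k => (p.1.1, splice l.succ p.1.2 p.2)) hs)
  · exact (hK.linGrowth_nested hM hm l.succ).comp hw
      (φ := fun p : (Θ × Mat N k) × Mat N k => (p.1.1, splice l.succ p.1.2 p.2)) hs
  · refine (hK.linGrowth_nested hM hm l.castSucc).comp hw (φ := Prod.fst)
      ((LinGrowth.self hw).of_le fun p => ?_)
    rw [abs_of_nonneg (hK.nonneg_prod _), abs_of_nonneg (hw _)]
    linarith [norm_nonneg p.2]

omit [Nonempty S] in
lemma Admissible.measurable_nestedDeriv_aux (hK : Admissible ρ K) (l : Fin k)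
    {D : Θ × Mat N k → ℝ} (hD : Measurable D) :
    Measurable (fun p : (Θ × Mat N k) × Mat N k => Real.exp (m l.succ *
      (nested M m (K p.1.1) l.succ (splice l.succ p.1.2 p.2) -
        nested M m (K p.1.1) l.castSucc p.1.2)) * D (p.1.1, splice l.succ p.1.2 p.2)) := by
  refine Measurable.mul (Measurable.exp (Measurable.const_mul (Measurable.sub ?_ ?_) _)) ?_
  · exact (hK.measurable_nested l.succ).comp (measurable_splice_param l.succ)
  · exact (hK.measurable_nested l.castSucc).comp measurable_fst
  · exact hD.comp (measurable_splice_param l.succ)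

omit [Nonempty S] in
lemma Admissible.measurable_nestedDeriv (hK : Admissible ρ K) (hd : Admissible ρ d)
    (l : Fin (k + 1)) :
    Measurable fun p : Θ × Mat N k => nestedDeriv M m (K p.1) (d p.1) l p.2 := by
  induction l using Fin.reverseInduction with
  | last =>
    simp only [nestedDeriv_last]
    exact hK.measurable_gibbsAvg hd
  | cast l ih =>
    simp only [nestedDeriv_castSucc]
    exact (StronglyMeasurable.integral_prod_right'
      (hK.measurable_nestedDeriv_aux l ih).stronglyMeasurable).measurable

lemma Admissible.expGrowth_nestedDeriv (hK : Admissible ρ K) (hd : Admissible ρ d)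
    (hM : SpliceInvariant M) (hm : ∀ l : Fin k, 0 < m l.succ) (l : Fin (k + 1)) :
    ExpGrowth (fun p : Θ × Mat N k => ρ p.1 + ‖p.2‖)
      fun p => nestedDeriv M m (K p.1) (d p.1) l p.2 := by
  induction l using Fin.reverseInduction with
  | last =>
    simp only [nestedDeriv_last]
    exact (hd.linGrowth_gibbsAvg K).expGrowth
  | cast l ih =>
    simp only [nestedDeriv_castSucc]
    exact (hK.expGrowth_nestedDeriv_aux hM hm l ih).integral hK.nonneg_prod hM.moments

/-- Differentiation of the recursion with respect to a parameter of the Hamiltonian. -/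
lemma hasDerivAt_nested {K d : ℝ → S → Mat N k → ℝ} (hK : Admissible (fun u : ℝ => |u|) K)
    (hd : Admissible (fun u : ℝ => |u|) d) (hM : SpliceInvariant M)
    (hm : ∀ l : Fin k, 0 < m l.succ)
    (hder : ∀ u σ z, HasDerivAt (fun u => K u σ z) (d u σ z) u) (l : Fin (k + 1)) (u : ℝ)
    (z : Mat N k) :
    HasDerivAt (fun u => nested M m (K u) l z) (nestedDeriv M m (K u) (d u) l z) u := by
  induction l using Fin.reverseInduction generalizing u z with
  | last =>
    simp only [nested_last, nestedDeriv_last]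
    have hpos : 0 < ∑ σ, Real.exp (K u σ z) :=
      Finset.sum_pos (fun _ _ => Real.exp_pos _) Finset.univ_nonempty
    refine ((HasDerivAt.fun_sum fun σ _ => (hder u σ z).exp).log hpos.ne').congr_deriv ?_
    rw [gibbsAvg]
    congr 1
    exact Finset.sum_congr rfl fun σ _ => mul_comm _ _
  | cast l ih =>
    have hw : ∀ p : ℝ × Mat N k, 0 ≤ |p.1| + ‖p.2‖ := fun p => by positivity
    have hs : LinGrowth (fun p : ℝ × Mat N k => |p.1| + ‖p.2‖)
        (fun p => |p.1| + ‖splice l.succ z p.2‖) := by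
      refine ((LinGrowth.const hw ‖z‖).add (LinGrowth.self hw)).of_le fun p => ?_
      rw [abs_of_nonneg (add_nonneg (abs_nonneg _) (norm_nonneg _)),
        abs_of_nonneg (add_nonneg (norm_nonneg _) (hw p))]
      linarith [norm_splice_le l.succ z p.2]
    have hsm : Measurable fun z' : Mat N k => splice l.succ z z' :=
      (measurable_splice l.succ).comp measurable_prodMk_left
    have := hasDerivAt_log_integral_exp (ν := M) (w' := fun z : Mat N k => ‖z‖)
      (F := fun u z' => nested M m (K u) l.succ (splice l.succ z z'))
      (F' := fun u z' => nestedDeriv M m (K u) (d u) l.succ (splice l.succ z z'))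
      (fun _ => norm_nonneg _) hM.moments
      ((hK.linGrowth_nested hM hm l.succ).comp hw (φ := fun p => (p.1, splice l.succ z p.2)) hs)
      ((hK.expGrowth_nestedDeriv hd hM hm l.succ).comp hw
        (φ := fun p => (p.1, splice l.succ z p.2)) hs)
      (fun u => ((hK.measurable_nested l.succ).comp measurable_prodMk_left).comp hsm)
      (fun u => ((hK.measurable_nestedDeriv hd l.succ).comp measurable_prodMk_left).comp hsm)
      (fun u z' => ih u (splice l.succ z z')) (hm l) u
    simpa only [nestedDeriv_castSucc, nested_castSucc] using this

end Nested

end Guerra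

end

/-! ### The weights of the replicas and the unrolled derivative. -/

noncomputable section

namespace Guerra

section Weights

variable {N k : ℕ} {S : Type*} [Fintype S]

/-- The weight of `σ` in `E ∏ W_l ⟨·⟩`, written without products. -/
def totalWeight (M : Measure (Mat N k)) (m : Fin (k + 1) → ℝ) (K : S → Mat N k → ℝ) (σ : S)
    (z : Mat N k) : ℝ :=
  Real.exp (K σ z - ∑ r : Fin k, (m r.succ - m r.castSucc) * nested M m K r.castSucc z)

/-- The weight of `τ` in `∏_{l ≥ r} W_l ⟨·⟩`. -/
def tailWeight (M : Measure (Mat N k)) (m : Fin (k + 1) → ℝ) (K : S → Mat N k → ℝ) (r : Fin k)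
    (τ : S) (z : Mat N k) : ℝ :=
  (∏ l ∈ Finset.univ.filter (fun l => r ≤ l), tilt M m K l z) *
    (Real.exp (K τ z) / ∑ τ', Real.exp (K τ' z))

lemma sum_succ_sub_castSucc (g : Fin (k + 1) → ℝ) :
    ∑ l : Fin k, (g l.succ - g l.castSucc) = g (Fin.last k) - g 0 := by
  rw [Finset.sum_sub_distrib]
  have h1 := Fin.sum_univ_succ g
  have h2 := Fin.sum_univ_castSucc g
  linarith

variable {M : Measure (Mat N k)} {m : Fin (k + 1) → ℝ}

/-- Summation by parts in `∑ m_l (X_l - X_{l-1})` leaves the boundary term `m_k X_k - m_0 X_0 =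
X_k`, and `exp X_k` cancels the partition function. The resulting single exponential is what
integration by parts can differentiate. -/
lemma prod_tilt_mul_gibbs [Nonempty S] (hm_zero : m 0 = 0) (hm_last : m (Fin.last k) = 1)
    (K : S → Mat N k → ℝ) (σ : S) (z : Mat N k) :
    (∏ l, tilt M m K l z) * (Real.exp (K σ z) / ∑ τ, Real.exp (K τ z)) = totalWeight M m K σ z := by
  have hpos : 0 < ∑ σ, Real.exp (K σ z) :=
    Finset.sum_pos (fun _ _ => Real.exp_pos _) Finset.univ_nonempty
  have hX : Real.exp (nested M m K (Fin.last k) z) = ∑ τ, Real.exp (K τ z) := by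
    rw [nested_last, Real.exp_log hpos]
  simp only [tilt, totalWeight]
  rw [← Real.exp_sum, ← hX, ← Real.exp_sub, ← Real.exp_add]
  congr 1
  have h := sum_succ_sub_castSucc fun l => m l * nested M m K l z
  simp only [hm_zero, hm_last, zero_mul, sub_zero, one_mul] at h
  have h' : ∑ l : Fin k, m l.succ * (nested M m K l.succ z - nested M m K l.castSucc z) =
      ∑ l : Fin k, (m l.succ * nested M m K l.succ z - m l.castSucc * nested M m K l.castSucc z) -
        ∑ r : Fin k, (m r.succ - m r.castSucc) * nested M m K r.castSucc z := by
    rw [← Finset.sum_sub_distrib]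
    exact Finset.sum_congr rfl fun l _ => by ring
  rw [h', h]
  ring

variable {Θ : Type*} [MeasurableSpace Θ] {ρ : Θ → ℝ} {K d : Θ → S → Mat N k → ℝ}
  [IsProbabilityMeasure M]

lemma Admissible.measurable_totalWeight (hK : Admissible ρ K) (σ : S) :
    Measurable fun p : Θ × Mat N k => totalWeight M m (K p.1) σ p.2 :=
  ((hK.meas σ).sub (Finset.measurable_sum _ fun r _ =>
    (hK.measurable_nested r.castSucc).const_mul _)).exp

lemma Admissible.measurable_tailWeight (hK : Admissible ρ K) (r : Fin k) (τ : S) :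
    Measurable fun p : Θ × Mat N k => tailWeight M m (K p.1) r τ p.2 := by
  refine Measurable.mul (Finset.measurable_prod _ fun l _ => ?_)
    ((hK.meas τ).exp.div (Finset.measurable_sum _ fun σ _ => (hK.meas σ).exp))
  exact (((hK.measurable_nested l.succ).sub (hK.measurable_nested l.castSucc)).const_mul _).exp

variable [Nonempty S]

lemma Admissible.expGrowth_totalWeight (hK : Admissible ρ K) (hM : SpliceInvariant M)
    (hm : ∀ l : Fin k, 0 < m l.succ) (σ : S) :
    ExpGrowth (fun p : Θ × Mat N k => ρ p.1 + ‖p.2‖) fun p => totalWeight M m (K p.1) σ p.2 :=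
  ((hK.growth σ).sub (LinGrowth.sum hK.nonneg_prod fun r _ =>
    (hK.linGrowth_nested hM hm r.castSucc).const_mul _)).exp

lemma Admissible.expGrowth_tailWeight (hK : Admissible ρ K) (hM : SpliceInvariant M)
    (hm : ∀ l : Fin k, 0 < m l.succ) (r : Fin k) (τ : S) :
    ExpGrowth (fun p : Θ × Mat N k => ρ p.1 + ‖p.2‖) fun p => tailWeight M m (K p.1) r τ p.2 := by
  refine ExpGrowth.mul (ExpGrowth.prod hK.nonneg_prod fun l _ => ?_)
    ((ExpGrowth.const hK.nonneg_prod 1).of_le fun p => ?_)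
  · exact (((hK.linGrowth_nested hM hm l.succ).sub
      (hK.linGrowth_nested hM hm l.castSucc)).const_mul _).exp
  · rw [abs_one]
    exact abs_gibbs_le (K p.1) τ p.2

omit [Fintype S] [Nonempty S] [IsProbabilityMeasure M] in
lemma Admissible.integrable_splice (hK : Admissible ρ K) (hM : SpliceInvariant M)
    {f : Θ × Mat N k → ℝ} (hf : ExpGrowth (fun p : Θ × Mat N k => ρ p.1 + ‖p.2‖) f)
    (hfm : Measurable f) (r : Fin (k + 1)) (θ : Θ) (z : Mat N k) :
    Integrable (fun z' => f (θ, splice r z z')) M :=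
  ExpGrowth.integrable_section (w := fun p : Θ × Mat N k => ρ p.1 + ‖p.2‖)
    (f := fun p : (Θ × Mat N k) × Mat N k => f (p.1.1, splice r p.1.2 p.2))
    (fun _ => norm_nonneg _) hM.moments
    (hf.comp (fun p => add_nonneg (hK.nonneg_prod p.1) (norm_nonneg _))
      (φ := fun p : (Θ × Mat N k) × Mat N k => (p.1.1, splice r p.1.2 p.2))
      (linGrowth_splice_weight hK.nonneg r)) (θ, z)
    ((hfm.comp (measurable_splice_param r)).comp measurable_prodMk_left)

lemma Admissible.integrable_exp_nested (hK : Admissible ρ K) (hM : SpliceInvariant M)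
    (hm : ∀ l : Fin k, 0 < m l.succ) (l : Fin k) (θ : Θ) (z : Mat N k) :
    Integrable (fun z' => Real.exp (m l.succ * nested M m (K θ) l.succ (splice l.succ z z'))) M :=
  hK.integrable_splice hM ((hK.linGrowth_nested hM hm l.succ).const_mul (m l.succ)).exp
    ((hK.measurable_nested l.succ).const_mul (m l.succ)).exp l.succ θ z

/-- The definition of `X_{l-1}` is the normalization of `exp (m_l X_l)` under `E_l`: each weight
`W_l` is a conditional probability density. -/
lemma Admissible.integral_tilt (hK : Admissible ρ K) (hM : SpliceInvariant M)
    (hm : ∀ l : Fin k, 0 < m l.succ) (l : Fin k) (θ : Θ) (z : Mat N k) :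
    ∫ z', Real.exp (m l.succ * (nested M m (K θ) l.succ (splice l.succ z z') -
      nested M m (K θ) l.castSucc z)) ∂M = 1 := by
  have hpos := integral_exp_pos (hK.integrable_exp_nested hM hm l θ z)
  have e : ∀ z', Real.exp (m l.succ * (nested M m (K θ) l.succ (splice l.succ z z') -
      nested M m (K θ) l.castSucc z)) =
      Real.exp (m l.succ * nested M m (K θ) l.succ (splice l.succ z z')) /
        ∫ z', Real.exp (m l.succ * nested M m (K θ) l.succ (splice l.succ z z')) ∂M := by
    intro z'
    rw [mul_sub, nested_castSucc, ← mul_assoc, mul_one_div_cancel (hm l).ne', one_mul,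
      Real.exp_sub, Real.exp_log hpos]
  simp_rw [e]
  rw [integral_div, div_self hpos.ne']

lemma Admissible.nestedDeriv_one (hK : Admissible ρ K) (hM : SpliceInvariant M)
    (hm : ∀ l : Fin k, 0 < m l.succ) (l : Fin (k + 1)) (θ : Θ) (z : Mat N k) :
    nestedDeriv M m (K θ) (fun _ _ => 1) l z = 1 := by
  induction l using Fin.reverseInduction generalizing z with
  | last =>
    have hpos : 0 < ∑ σ, Real.exp (K θ σ z) :=
      Finset.sum_pos (fun _ _ => Real.exp_pos _) Finset.univ_nonempty
    simp [nestedDeriv_last, gibbsAvg, hpos.ne']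
  | cast l ih => simp only [nestedDeriv_castSucc, ih, mul_one, hK.integral_tilt hM hm]

omit [IsProbabilityMeasure M] [Nonempty S] in
lemma tailWeight_sum (K d : S → Mat N k → ℝ) (r : Fin k) (z : Mat N k) :
    ∑ τ, tailWeight M m K r τ z * d τ z =
      (∏ l ∈ Finset.univ.filter (fun l => r ≤ l), tilt M m K l z) * gibbsAvg K d z := by
  simp only [tailWeight, gibbsAvg_eq_sum, Finset.mul_sum, mul_assoc]

/-- The recursion for the derivative, unrolled. -/
lemma Admissible.nestedDeriv_eq_integral (hK : Admissible ρ K) (hd : Admissible ρ d)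
    (hM : SpliceInvariant M) (hm : ∀ l : Fin k, 0 < m l.succ) (θ : Θ) (r : Fin k) (z : Mat N k) :
    nestedDeriv M m (K θ) (d θ) r.castSucc z =
      ∫ z', ∑ τ, tailWeight M m (K θ) r τ (splice r.succ z z') * d θ τ (splice r.succ z z') ∂M := by
  -- The reverse induction lives on `Fin (k + 1)` while `r` ranges over `Fin k`; the case of the
  -- last index is therefore vacuous, and the true base case `r.succ = Fin.last k` is treated inside
  -- the inductive step.
  suffices h : ∀ l : Fin (k + 1), ∀ r : Fin k, r.castSucc = l → ∀ z,
      nestedDeriv M m (K θ) (d θ) r.castSucc z = ∫ z', ∑ τ, tailWeight M m (K θ) r τ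
        (splice r.succ z z') * d θ τ (splice r.succ z z') ∂M from h _ r rfl z
  intro l
  induction l using Fin.reverseInduction with
  | last => exact fun r hr => absurd hr (Fin.castSucc_lt_last r).ne
  | cast l ih =>
    intro r hr z
    obtain rfl := Fin.castSucc_injective _ hr
    simp only [tailWeight_sum]
    rw [nestedDeriv_castSucc]
    have htilt : ∀ z', Real.exp (m r.succ * (nested M m (K θ) r.succ (splice r.succ z z') -
        nested M m (K θ) r.castSucc z)) = tilt M m (K θ) r (splice r.succ z z') := fun z' => by
      rw [tilt, nested_castSucc_splice M m (K θ) le_rfl]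
    simp only [htilt]
    rcases eq_or_ne r.succ (Fin.last k) with hlast | hlast
    · have hf : Finset.univ.filter (fun l => r ≤ l) = {r} := by
        ext l
        simp only [Finset.mem_filter, Finset.mem_univ, true_and, Finset.mem_singleton]
        refine ⟨fun h => le_antisymm ?_ h, fun h => h ▸ le_rfl⟩
        rw [← Fin.succ_le_succ_iff, hlast]
        exact Fin.le_last _
      simp only [hf, Finset.prod_singleton, hlast, nestedDeriv_last]
    · obtain ⟨r', hr'⟩ := Fin.exists_castSucc_eq.2 hlast
      have hrr : r < r' := by
        rw [← Fin.castSucc_lt_castSucc_iff, hr']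
        exact Fin.castSucc_lt_succ
      have hf : Finset.univ.filter (fun l => r ≤ l) =
          insert r (Finset.univ.filter (fun l => r' ≤ l)) := by
        ext l
        simp only [Finset.mem_filter, Finset.mem_univ, true_and, Finset.mem_insert]
        have hv : (r' : ℕ) = r + 1 := by simpa using congrArg Fin.val hr'
        simp only [Fin.le_def, Fin.ext_iff]
        omega
      have hsucc : r.succ ≤ r'.succ := Fin.succ_le_succ_iff.2 hrr.le
      have hnot : r ∉ Finset.univ.filter (fun l => r' ≤ l) := by simp [hrr]
      set F : Mat N k → ℝ := fun y => (∏ l ∈ Finset.univ.filter (fun l => r ≤ l),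
        tilt M m (K θ) l y) * gibbsAvg (K θ) (d θ) y with hF
      have hFsum : ∀ y, F y = ∑ τ, tailWeight M m (K θ) r τ y * d θ τ y := fun y =>
        (tailWeight_sum (K θ) (d θ) r y).symm
      -- The weight at level `r` depends only on columns that the next resampling keeps, so it may
      -- be evaluated at the resampled matrix and moved inside the inner integral.
      have key : ∀ z', tilt M m (K θ) r (splice r.succ z z') *
          nestedDeriv M m (K θ) (d θ) r.succ (splice r.succ z z') =
          ∫ z'', F (splice r.succ z (splice r'.succ z' z'')) ∂M := by
        intro z'
        rw [← hr', ih r' hr', ← integral_const_mul]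
        refine integral_congr_ae (Filter.Eventually.of_forall fun z'' => ?_)
        simp only [tailWeight_sum, hF, hf, Finset.prod_insert hnot]
        have ht : tilt M m (K θ) r (splice r.succ z z') =
            tilt M m (K θ) r (splice r'.succ (splice r.succ z z') z'') := by
          rw [tilt, tilt, nested_castSucc_splice M m (K θ) hsucc, ← hr',
            nested_castSucc_splice M m (K θ) le_rfl]
        rw [hr', ht, splice_splice hsucc]
        ring
      simp only [key]
      have hFm : Measurable fun p : Θ × Mat N k =>
          ∑ τ, tailWeight M m (K p.1) r τ p.2 * d p.1 τ p.2 :=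
        Finset.measurable_sum _ fun τ _ => (hK.measurable_tailWeight r τ).mul (hd.meas τ)
      have hFg : ExpGrowth (fun p : Θ × Mat N k => ρ p.1 + ‖p.2‖) fun p =>
          ∑ τ, tailWeight M m (K p.1) r τ p.2 * d p.1 τ p.2 :=
        ExpGrowth.sum hK.nonneg_prod fun τ _ =>
          (hK.expGrowth_tailWeight hM hm r τ).mul (hd.growth τ).expGrowth
      have hFi : Integrable (fun z' => F (splice r.succ z z')) M := by
        simp only [hFsum]
        exact hK.integrable_splice hM hFg hFm r.succ θ z
      -- Two successive independent resamplings have the same law as a single one.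
      have hmp := hM.splice r'.succ
      have hFi' : AEStronglyMeasurable (fun z' => F (splice r.succ z z'))
          ((M.prod M).map fun p => splice r'.succ p.1 p.2) := by
        rw [hmp.map_eq]; exact hFi.aestronglyMeasurable
      have h1 := integral_prod (fun p : Mat N k × Mat N k =>
        F (splice r.succ z (splice r'.succ p.1 p.2))) (hmp.integrable_comp_of_integrable hFi)
      have h2 := integral_map hmp.measurable.aemeasurable hFi'
      rw [hmp.map_eq] at h2
      exact h1.symm.trans h2.symm

lemma hasDerivAt_totalWeight {K d : ℝ → S → Mat N k → ℝ} (hK : Admissible (fun u : ℝ => |u|) K)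
    (hd : Admissible (fun u : ℝ => |u|) d) (hM : SpliceInvariant M)
    (hm : ∀ l : Fin k, 0 < m l.succ)
    (hder : ∀ u σ z, HasDerivAt (fun u => K u σ z) (d u σ z) u) (u : ℝ) (σ : S) (z : Mat N k) :
    HasDerivAt (fun u => totalWeight M m (K u) σ z)
      (totalWeight M m (K u) σ z * (d u σ z - ∑ r : Fin k, (m r.succ - m r.castSucc) *
        nestedDeriv M m (K u) (d u) r.castSucc z)) u :=
  ((hder u σ z).sub (HasDerivAt.fun_sum fun r _ =>
    (hasDerivAt_nested hK hd hM hm hder r.castSucc u z).const_mul _)).exp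

end Weights

end Guerra

end

/-! ### The Gaussian law of the matrix `Z`: moments, splicing and covariances. -/

noncomputable section

namespace Guerra

section Gaussian

lemma isGaussian_pi {ι : Type*} [Fintype ι] {E : ι → Type*} [∀ i, NormedAddCommGroup (E i)]
    [∀ i, NormedSpace ℝ (E i)] [∀ i, MeasurableSpace (E i)] [∀ i, BorelSpace (E i)]
    [∀ i, CompleteSpace (E i)] [∀ i, SecondCountableTopology (E i)] (μ : ∀ i, Measure (E i))
    [∀ i, IsGaussian (μ i)] : IsGaussian (Measure.pi μ) := by
  have h : HasGaussianLaw (fun ω : ∀ i, E i => fun i => ω i) (Measure.pi μ) := by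
    refine iIndepFun.hasGaussianLaw (X := fun i (ω : ∀ i, E i) => ω i) (fun i => ⟨?_⟩)
      (iIndepFun_pi (X := fun i (x : E i) => x) fun i => aemeasurable_id)
    rw [(measurePreserving_eval μ i).map_eq]
    infer_instance
  simpa using h.isGaussian_map

lemma integral_eval_pi {ι : Type*} [Fintype ι] {α : Type*} [MeasurableSpace α]
    (μ : ι → Measure α) [∀ i, IsProbabilityMeasure (μ i)] (i : ι) {f : α → ℝ} (hf : Measurable f) :
    ∫ x, f (x i) ∂(Measure.pi μ) = ∫ y, f y ∂(μ i) :=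
  integral_comp_eval (X := fun _ : ι => α) hf.aestronglyMeasurable

/-- Fernique's theorem gives a finite `E exp (C ‖x‖²)` for some `C > 0`, and completing the square
gives `c ‖x‖ ≤ C ‖x‖² + c² / (4C)`. -/
lemma expMoments_norm {E : Type*} [NormedAddCommGroup E] [NormedSpace ℝ E] [MeasurableSpace E]
    [BorelSpace E] [CompleteSpace E] [SecondCountableTopology E] (μ : Measure E) [IsGaussian μ] :
    ExpMoments (fun x => ‖x‖) μ := by
  intro c
  obtain ⟨C, hC, hi⟩ := IsGaussian.exists_integrable_exp_sq μ
  refine (hi.const_mul (Real.exp (c ^ 2 / (4 * C)))).mono' (by fun_prop)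
    (Filter.Eventually.of_forall fun x => ?_)
  rw [Real.norm_eq_abs, Real.abs_exp, ← Real.exp_add]
  refine Real.exp_le_exp.2 ?_
  have h : 0 ≤ (2 * C * ‖x‖ - c) ^ 2 / (4 * C) := by positivity
  have e : (2 * C * ‖x‖ - c) ^ 2 / (4 * C) = C * ‖x‖ ^ 2 - c * ‖x‖ + c ^ 2 / (4 * C) := by
    field_simp
    ring
  linarith

end Gaussian

section Law

variable (ξ : ℝ → ℝ) (N : ℕ) {k : ℕ} (q : Fin (k + 2) → ℝ)

instance isGaussian_matLaw : IsGaussian (matLaw ξ N q) := by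
  have := isGaussian_pi fun l : Fin (k + 1) =>
    gaussianReal 0 (Real.toNNReal (deriv ξ (q l.succ) - deriv ξ (q l.castSucc)))
  exact isGaussian_pi _

lemma measurePreserving_pi_combine {ι : Type*} [Fintype ι] {α : Type*} [MeasurableSpace α]
    (μ : ι → Measure α) [∀ i, IsProbabilityMeasure (μ i)] {φ : ι → α × α → α}
    (hφ : ∀ i, MeasurePreserving (φ i) ((μ i).prod (μ i)) (μ i)) :
    MeasurePreserving (fun p : (ι → α) × (ι → α) => fun i => φ i (p.1 i, p.2 i))
      ((Measure.pi μ).prod (Measure.pi μ)) (Measure.pi μ) :=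
  (measurePreserving_pi _ _ hφ).comp
    ((measurePreserving_arrowProdEquivProdArrow α α ι μ μ).symm _)

/-- The entries are independent, so choosing each entry from one of two independent copies, by a
rule that depends only on its column, reproduces the law. The product argument is applied to the
columns of one row and then to the rows. -/
lemma spliceInvariant_matLaw : SpliceInvariant (matLaw ξ N q) where
  moments := expMoments_norm _
  splice r := by
    unfold matLaw
    set g : Fin (k + 1) → Measure ℝ := fun l =>
      gaussianReal 0 (Real.toNNReal (deriv ξ (q l.succ) - deriv ξ (q l.castSucc))) with hg
    have hrow : MeasurePreserving (fun p : (Fin (k + 1) → ℝ) × (Fin (k + 1) → ℝ) =>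
        fun j => if j < r then p.1 j else p.2 j)
        ((Measure.pi g).prod (Measure.pi g)) (Measure.pi g) := by
      refine measurePreserving_pi_combine g
        (φ := fun j p => if j < r then p.1 else p.2) fun j => ?_
      by_cases hj : j < r
      · simpa only [hj, if_true] using measurePreserving_fst
      · simpa only [hj, if_false] using measurePreserving_snd
    exact measurePreserving_pi_combine (fun _ : Fin N => Measure.pi g)
      (φ := fun _ p => fun j => if j < r then p.1 j else p.2 j) fun _ => hrow

variable {N} in
lemma integral_matLaw_row (i : Fin N) {f : (Fin (k + 1) → ℝ) → ℝ} (hf : Measurable f) :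
    ∫ z, f (z i) ∂(matLaw ξ N q) = ∫ y, f y ∂(Measure.pi fun l : Fin (k + 1) =>
      gaussianReal 0 (Real.toNNReal (deriv ξ (q l.succ) - deriv ξ (q l.castSucc)))) :=
  integral_eval_pi _ i hf

lemma integral_matLaw_entry (i : Fin N) (j : Fin (k + 1)) : ∫ z, z i j ∂(matLaw ξ N q) = 0 := by
  rw [integral_matLaw_row ξ q i (f := fun y => y j) (by fun_prop),
    integral_eval_pi _ j (f := fun y : ℝ => y) measurable_id, integral_id_gaussianReal]

variable {ξ q}

/-- Monotonicity of `ξ'` along `q` is needed so that `Real.toNNReal` does not truncate the variance.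
-/
lemma integral_matLaw_entry_mul (hq : ∀ l : Fin (k + 1), deriv ξ (q l.castSucc) ≤ deriv ξ (q l.succ))
    (i i' : Fin N) (j j' : Fin (k + 1)) :
    ∫ z, z i j * z i' j' ∂(matLaw ξ N q) =
      if i = i' ∧ j = j' then deriv ξ (q j.succ) - deriv ξ (q j.castSucc) else 0 := by
  by_cases hi : i = i'
  · subst hi
    rw [integral_matLaw_row ξ q i (f := fun y => y j * y j') (by fun_prop)]
    by_cases hj : j = j'
    · subst hj
      rw [integral_eval_pi _ j (f := fun y : ℝ => y * y) (by fun_prop)]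
      have := variance_fun_id_gaussianReal (μ := 0)
        (v := Real.toNNReal (deriv ξ (q j.succ) - deriv ξ (q j.castSucc)))
      rw [variance_of_integral_eq_zero (by fun_prop) integral_id_gaussianReal,
        Real.coe_toNNReal _ (sub_nonneg.2 (hq j))] at this
      simpa [sq] using this
    · have hind := (iIndepFun_pi (μ := fun l : Fin (k + 1) =>
        gaussianReal 0 (Real.toNNReal (deriv ξ (q l.succ) - deriv ξ (q l.castSucc))))
        (X := fun _ x => x) fun _ => aemeasurable_id).indepFun hj
      rw [hind.integral_fun_mul_eq_mul_integral (measurable_pi_apply j).aestronglyMeasurable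
        (measurable_pi_apply j').aestronglyMeasurable,
        integral_eval_pi _ j (f := fun y : ℝ => y) measurable_id, integral_id_gaussianReal]
      simp [hj]
  · have hind := ((iIndepFun_pi (μ := fun _ : Fin N => Measure.pi fun l : Fin (k + 1) =>
        gaussianReal 0 (Real.toNNReal (deriv ξ (q l.succ) - deriv ξ (q l.castSucc))))
        (X := fun _ x => x) fun _ => aemeasurable_id).indepFun hi).comp
        (measurable_pi_apply j) (measurable_pi_apply j')
    have h0 := integral_matLaw_entry ξ N q i j
    have := hind.integral_fun_mul_eq_mul_integral
      (show Measurable fun z : Mat N k => z i j by fun_prop).aestronglyMeasurable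
      (show Measurable fun z : Mat N k => z i' j' by fun_prop).aestronglyMeasurable
    simp only [Function.comp_apply] at this
    unfold matLaw at h0 ⊢
    rw [this, h0]
    simp [hi]

end Law

end Guerra

end

/-! ### Expectations over two replicas, and their dependence on a parameter. -/

noncomputable section

namespace Guerra

section Pair

variable {N k : ℕ} {S : Type*} [Fintype S] {Θ : Type*} [MeasurableSpace Θ]

/-- The expectation of the product of the weights of `σ` and `τ` for two replicas sharing the
columns up to `r`. -/
def pairWeight (γ : Measure Θ) (M : Measure (Mat N k)) (m : Fin (k + 1) → ℝ)
    (K : Θ → S → Mat N k → ℝ) (r : Fin k) (σ τ : S) : ℝ :=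
  ∫ x : Θ × Mat N k × Mat N k, totalWeight M m (K x.1) σ x.2.1 *
    tailWeight M m (K x.1) r τ (splice r.succ x.2.1 x.2.2) ∂(γ.prod (M.prod M))

variable {M : Measure (Mat N k)} {m : Fin (k + 1) → ℝ} {γ : Measure Θ} {ρ : Θ → ℝ}
  {K d : Θ → S → Mat N k → ℝ} [IsProbabilityMeasure M]

lemma Admissible.measurable_pair (hK : Admissible ρ K) (r : Fin k) (σ τ : S) :
    Measurable fun x : Θ × Mat N k × Mat N k => totalWeight M m (K x.1) σ x.2.1 *
      tailWeight M m (K x.1) r τ (splice r.succ x.2.1 x.2.2) := by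
  have h1 : Measurable fun x : Θ × Mat N k × Mat N k => (x.1, x.2.1) :=
    measurable_fst.prodMk (measurable_fst.comp measurable_snd)
  have h2 : Measurable fun x : Θ × Mat N k × Mat N k => (x.1, splice r.succ x.2.1 x.2.2) :=
    measurable_fst.prodMk ((measurable_splice r.succ).comp measurable_snd)
  have h3 := (hK.measurable_totalWeight (M := M) (m := m) σ).comp h1
  have h4 := (hK.measurable_tailWeight (M := M) (m := m) r τ).comp h2
  exact h3.mul h4

variable [Nonempty S]

lemma Admissible.expGrowth_pair (hK : Admissible ρ K) (hM : SpliceInvariant M)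
    (hm : ∀ l : Fin k, 0 < m l.succ) (r : Fin k) (σ τ : S) :
    ExpGrowth (fun x : Θ × Mat N k × Mat N k => ρ x.1 + (‖x.2.1‖ + ‖x.2.2‖))
      fun x => totalWeight M m (K x.1) σ x.2.1 *
        tailWeight M m (K x.1) r τ (splice r.succ x.2.1 x.2.2) := by
  have hw : ∀ x : Θ × Mat N k × Mat N k, 0 ≤ ρ x.1 + (‖x.2.1‖ + ‖x.2.2‖) := fun x =>
    add_nonneg (hK.nonneg _) (add_nonneg (norm_nonneg _) (norm_nonneg _))
  refine ExpGrowth.mul ?_ ?_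
  · refine (hK.expGrowth_totalWeight hM hm σ).comp hw (φ := fun x => (x.1, x.2.1))
      ((LinGrowth.self hw).of_le fun x => ?_)
    rw [abs_of_nonneg (hw x), abs_of_nonneg (add_nonneg (hK.nonneg _) (norm_nonneg _))]
    linarith [norm_nonneg x.2.2]
  · refine (hK.expGrowth_tailWeight hM hm r τ).comp hw
      (φ := fun x => (x.1, splice r.succ x.2.1 x.2.2)) ((LinGrowth.self hw).of_le fun x => ?_)
    rw [abs_of_nonneg (hw x), abs_of_nonneg (add_nonneg (hK.nonneg _) (norm_nonneg _))]
    linarith [norm_splice_le r.succ x.2.1 x.2.2]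

variable [IsProbabilityMeasure γ]

lemma Admissible.integrable_pair (hK : Admissible ρ K) (hM : SpliceInvariant M)
    (hγ : ExpMoments ρ γ) (hm : ∀ l : Fin k, 0 < m l.succ) (r : Fin k) (σ τ : S) :
    Integrable (fun x : Θ × Mat N k × Mat N k => totalWeight M m (K x.1) σ x.2.1 *
      tailWeight M m (K x.1) r τ (splice r.succ x.2.1 x.2.2)) (γ.prod (M.prod M)) :=
  (hK.expGrowth_pair hM hm r σ τ).integrable (hK.measurable_pair r σ τ).aestronglyMeasurable
    (hγ.prod (hM.moments.prod hM.moments))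

lemma SpliceInvariant.integrable_prod (hM : SpliceInvariant M) (hγ : ExpMoments ρ γ)
    {f : Θ × Mat N k → ℝ} (hf : ExpGrowth (fun p : Θ × Mat N k => ρ p.1 + ‖p.2‖) f)
    (hfm : Measurable f) : Integrable f (γ.prod M) :=
  hf.integrable hfm.aestronglyMeasurable (hγ.prod hM.moments)

omit [Fintype S] [Nonempty S] in
lemma admissible_const (hρ : ∀ θ, 0 ≤ ρ θ) (δ : S → ℝ) :
    Admissible (N := N) (k := k) ρ (fun _ σ _ => δ σ) where
  nonneg := hρ
  meas _ := measurable_const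
  growth _ := LinGrowth.const (fun _ => add_nonneg (hρ _) (norm_nonneg _)) _

/-- This is where the second replica appears: the derivative of `X_{r-1}`, once unrolled, is an
integral over an independent resampling of the columns from `r` on. -/
lemma Admissible.integral_totalWeight_mul_nestedDeriv (hK : Admissible ρ K)
    (hM : SpliceInvariant M) (hγ : ExpMoments ρ γ) (hm : ∀ l : Fin k, 0 < m l.succ) (r : Fin k)
    (σ : S) (δ : S → ℝ) :
    ∫ p : Θ × Mat N k, totalWeight M m (K p.1) σ p.2 *
      nestedDeriv M m (K p.1) (fun τ _ => δ τ) r.castSucc p.2 ∂(γ.prod M) =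
      ∑ τ, δ τ * pairWeight γ M m K r σ τ := by
  have hδ : Admissible (N := N) (k := k) ρ (fun _ σ _ => δ σ) := admissible_const hK.nonneg δ
  have hpair := fun τ => hK.integrable_pair hM hγ hm r σ τ
  have hs : Integrable (fun x : Θ × Mat N k × Mat N k => ∑ τ, δ τ *
      (totalWeight M m (K x.1) σ x.2.1 * tailWeight M m (K x.1) r τ (splice r.succ x.2.1 x.2.2)))
      (γ.prod (M.prod M)) := integrable_finsetSum _ fun τ _ => (hpair τ).const_mul _
  have h1 : ∑ τ, δ τ * pairWeight γ M m K r σ τ =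
      ∫ x : Θ × Mat N k × Mat N k, ∑ τ, δ τ * (totalWeight M m (K x.1) σ x.2.1 *
        tailWeight M m (K x.1) r τ (splice r.succ x.2.1 x.2.2)) ∂(γ.prod (M.prod M)) := by
    rw [integral_finsetSum _ fun τ _ => (hpair τ).const_mul _]
    simp only [integral_const_mul, pairWeight]
  have hi : Integrable (fun p : Θ × Mat N k => totalWeight M m (K p.1) σ p.2 *
      nestedDeriv M m (K p.1) (fun τ _ => δ τ) r.castSucc p.2) (γ.prod M) :=
    hM.integrable_prod hγ ((hK.expGrowth_totalWeight hM hm σ).mul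
      (hK.expGrowth_nestedDeriv hδ hM hm r.castSucc))
      ((hK.measurable_totalWeight σ).mul (hK.measurable_nestedDeriv hδ r.castSucc))
  rw [h1, integral_prod _ hs, integral_prod _ hi]
  refine integral_congr_ae ?_
  filter_upwards [hs.prod_right_ae] with θ hθ
  rw [integral_prod _ hθ]
  refine integral_congr_ae (Filter.Eventually.of_forall fun z => ?_)
  simp only
  rw [hK.nestedDeriv_eq_integral hδ hM hm, ← integral_const_mul]
  refine integral_congr_ae (Filter.Eventually.of_forall fun z' => ?_)
  simp only [Finset.mul_sum]
  exact Finset.sum_congr rfl fun τ _ => by ring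

lemma Admissible.integral_nestedDeriv_zero (hK : Admissible ρ K) (hd : Admissible ρ d)
    (hM : SpliceInvariant M) (hγ : ExpMoments ρ γ) (hm : ∀ l : Fin k, 0 < m l.succ)
    (hm_zero : m 0 = 0) (hm_last : m (Fin.last k) = 1) (hk : 0 < k) :
    ∫ p : Θ × Mat N k, nestedDeriv M m (K p.1) (d p.1) 0 p.2 ∂(γ.prod M) =
      ∑ σ, ∫ p : Θ × Mat N k, totalWeight M m (K p.1) σ p.2 * d p.1 σ p.2 ∂(γ.prod M) := by
  have hi : ∀ σ, Integrable (fun p : Θ × Mat N k => totalWeight M m (K p.1) σ p.2 *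
      d p.1 σ p.2) (γ.prod M) := fun σ =>
    hM.integrable_prod hγ ((hK.expGrowth_totalWeight hM hm σ).mul (hd.growth σ).expGrowth)
      ((hK.measurable_totalWeight σ).mul (hd.meas σ))
  have hs : Integrable (fun p : Θ × Mat N k => ∑ σ, totalWeight M m (K p.1) σ p.2 *
      d p.1 σ p.2) (γ.prod M) := integrable_finsetSum _ fun σ _ => hi σ
  have h0 : Integrable (fun p : Θ × Mat N k => nestedDeriv M m (K p.1) (d p.1) 0 p.2)
      (γ.prod M) :=
    hM.integrable_prod hγ (hK.expGrowth_nestedDeriv hd hM hm 0) (hK.measurable_nestedDeriv hd 0)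
  rw [← integral_finsetSum _ fun σ _ => hi σ, integral_prod _ h0, integral_prod _ hs]
  refine integral_congr_ae ?_
  filter_upwards [hs.prod_right_ae] with θ hθ
  -- At the lowest level the tail product contains every `W_l`, so the tail weight is the total
  -- weight. Integrating over `z` as well merges column `0` of `z` with the other columns of `z'`
  -- into one matrix of the original law.
  have hr : ∀ z, nestedDeriv M m (K θ) (d θ) 0 z = ∫ z', ∑ σ, totalWeight M m (K θ) σ
      (splice (Fin.succ ⟨0, hk⟩) z z') * d θ σ (splice (Fin.succ ⟨0, hk⟩) z z') ∂M := fun z => by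
    have h := hK.nestedDeriv_eq_integral hd hM hm θ ⟨0, hk⟩ z
    have hf : Finset.univ.filter (fun l : Fin k => (⟨0, hk⟩ : Fin k) ≤ l) = Finset.univ := by
      ext l
      simp [Fin.le_def]
    have ht : ∀ σ y, tailWeight M m (K θ) ⟨0, hk⟩ σ y = totalWeight M m (K θ) σ y := fun σ y => by
      rw [tailWeight, hf, prod_tilt_mul_gibbs hm_zero hm_last]
    simp only [ht] at h
    exact h
  simp only [hr]
  have hmp := hM.splice (Fin.succ ⟨0, hk⟩)
  have h1 := integral_prod _ (hmp.integrable_comp_of_integrable hθ)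
  have hθ' := hθ.aestronglyMeasurable
  rw [← hmp.map_eq] at hθ'
  have h2 := integral_map hmp.measurable.aemeasurable hθ'
  rw [hmp.map_eq] at h2
  exact h1.symm.trans h2.symm

/-- The tail weights of the second replica have conditional mass one, so summing it out leaves the
first replica. Together with `Admissible.sum_integral_totalWeight` this is `μ_r(1) = 1`. -/
lemma Admissible.sum_pairWeight (hK : Admissible ρ K) (hM : SpliceInvariant M)
    (hγ : ExpMoments ρ γ) (hm : ∀ l : Fin k, 0 < m l.succ) (r : Fin k) (σ : S) :
    ∑ τ, pairWeight γ M m K r σ τ = ∫ p : Θ × Mat N k, totalWeight M m (K p.1) σ p.2 ∂(γ.prod M) := by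
  have h := hK.integral_totalWeight_mul_nestedDeriv hM hγ hm r σ fun _ => 1
  simp only [hK.nestedDeriv_one hM hm, mul_one, one_mul] at h
  exact h.symm

lemma Admissible.sum_integral_totalWeight (hK : Admissible ρ K) (hM : SpliceInvariant M)
    (hγ : ExpMoments ρ γ) (hm : ∀ l : Fin k, 0 < m l.succ)
    (hm_zero : m 0 = 0) (hm_last : m (Fin.last k) = 1) (hk : 0 < k) :
    ∑ σ, ∫ p : Θ × Mat N k, totalWeight M m (K p.1) σ p.2 ∂(γ.prod M) = 1 := by
  have h := hK.integral_nestedDeriv_zero (admissible_const hK.nonneg fun _ => 1) hM hγ hm hm_zero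
    hm_last hk
  simp only [hK.nestedDeriv_one hM hm, mul_one] at h
  simpa using h.symm

end Pair

section Path

variable {N k : ℕ} {S : Type*} [Fintype S] [Nonempty S] {V : Type*} [MeasurableSpace V] {ρ : V → ℝ}
  {γ : Measure V} [IsProbabilityMeasure γ]
  {M : Measure (Mat N k)} [IsProbabilityMeasure M] {m : Fin (k + 1) → ℝ}
  {K d : ℝ × V → S → Mat N k → ℝ}

omit [Fintype S] [Nonempty S] in
lemma Admissible.path (hK : Admissible (fun p : ℝ × V => ρ p.2) K) (h : V) :
    Admissible (fun u : ℝ => |u|) fun u => K (u, h) :=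
  hK.comp (fun _ => abs_nonneg _) measurable_prodMk_right
    (LinGrowth.const (fun _ => abs_nonneg _) (ρ h))

omit [Fintype S] [Nonempty S] in
lemma Admissible.slice (hK : Admissible (fun p : ℝ × V => ρ p.2) K) (s : ℝ) :
    Admissible ρ fun h => K (s, h) :=
  hK.comp (fun h => hK.nonneg (s, h)) measurable_prodMk_left
    (LinGrowth.self fun h => hK.nonneg (s, h))

/-- The growth weight `ρ p.2` does not see the parameter `s`, so one integrable function dominates
for all `s` at once. -/
lemma continuous_pairWeight (hK : Admissible (fun p : ℝ × V => ρ p.2) K)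
    (hd : Admissible (fun p : ℝ × V => ρ p.2) d)
    (hder : ∀ h u σ z, HasDerivAt (fun u => K (u, h) σ z) (d (u, h) σ z) u)
    (hM : SpliceInvariant M) (hγ : ExpMoments ρ γ)
    (hm : ∀ l : Fin k, 0 < m l.succ) (r : Fin k) (σ τ : S) :
    Continuous fun s : ℝ => pairWeight γ M m (fun h => K (s, h)) r σ τ := by
  obtain ⟨C, -, hC⟩ := hK.expGrowth_pair (M := M) hM hm r σ τ
  have hnest : ∀ l h z, Continuous fun s => nested M m (K (s, h)) l z := fun l h z =>
    continuous_iff_continuousAt.2 fun s =>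
      (hasDerivAt_nested (hK.path h) (hd.path h) hM hm (hder h) l s z).continuousAt
  have hKc : ∀ σ h z, Continuous fun s => K (s, h) σ z := fun σ h z =>
    continuous_iff_continuousAt.2 fun s => (hder h s σ z).continuousAt
  refine continuous_of_dominated
    (bound := fun x => Real.exp C * Real.exp (C * (ρ x.1 + (‖x.2.1‖ + ‖x.2.2‖))))
    (fun s => ((hK.slice s).measurable_pair r σ τ).aestronglyMeasurable)
    (fun s => Filter.Eventually.of_forall fun x => ?_)
    ((hγ.prod (hM.moments.prod hM.moments) C).const_mul _)
    (Filter.Eventually.of_forall fun x => ?_)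
  · rw [← Real.exp_add]
    exact (hC ((s, x.1), x.2)).trans_eq (by ring_nf)
  · simp only [totalWeight, tailWeight, tilt]
    refine Continuous.mul (Continuous.rexp ((hKc _ _ _).sub (continuous_finsetSum _ fun r _ =>
      (hnest _ _ _).const_mul _))) (Continuous.mul (continuous_finsetProd _ fun l _ =>
        Continuous.rexp (((hnest _ _ _).sub (hnest _ _ _)).const_mul _))
        (Continuous.div ?_ ?_ fun s => ?_))
    · exact (hKc _ _ _).rexp
    · exact continuous_finsetSum _ fun σ _ => (hKc _ _ _).rexp
    · exact (Finset.sum_pos (fun _ _ => Real.exp_pos _) Finset.univ_nonempty).ne'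

lemma hasDerivAt_integral_nested (hK : Admissible (fun p : ℝ × V => ρ p.2) K)
    (hd : Admissible (fun p : ℝ × V => ρ p.2) d)
    (hder : ∀ h u σ z, HasDerivAt (fun u => K (u, h) σ z) (d (u, h) σ z) u)
    (hM : SpliceInvariant M) (hγ : ExpMoments ρ γ)
    (hm : ∀ l : Fin k, 0 < m l.succ) (l : Fin (k + 1)) (s : ℝ) :
    HasDerivAt (fun s => ∫ p : V × Mat N k, nested M m (K (s, p.1)) l p.2 ∂(γ.prod M))
      (∫ p : V × Mat N k, nestedDeriv M m (K (s, p.1)) (d (s, p.1)) l p.2 ∂(γ.prod M)) s := by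
  obtain ⟨C, -, hC⟩ := hK.expGrowth_nestedDeriv (M := M) hd hM hm l
  refine (hasDerivAt_integral_of_dominated_loc_of_deriv_le (Filter.univ_mem)
    (F' := fun s (p : V × Mat N k) => nestedDeriv M m (K (s, p.1)) (d (s, p.1)) l p.2)
    (bound := fun p : V × Mat N k => Real.exp C * Real.exp (C * (ρ p.1 + ‖p.2‖)))
    (Filter.Eventually.of_forall fun s =>
      ((hK.slice s).measurable_nested l).aestronglyMeasurable)
    (hM.integrable_prod hγ ((hK.slice s).linGrowth_nested hM hm l).expGrowth
      ((hK.slice s).measurable_nested l))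
    ((hK.slice s).measurable_nestedDeriv (hd.slice s) l).aestronglyMeasurable
    (Filter.Eventually.of_forall fun p s _ => ?_)
    ((hγ.prod hM.moments C).const_mul _)
    (Filter.Eventually.of_forall fun p s _ => ?_)).2
  · rw [← Real.exp_add]
    exact (hC ((s, p.1), p.2)).trans_eq (by ring_nf)
  · exact hasDerivAt_nested (hK.path p.1) (hd.path p.1) hM hm (hder p.1) l s p.2

end Path

end Guerra

end

/-! ### Directional derivatives of the total weight for the Hamiltonian `a h(σ) + b s·σ`. -/

noncomputable section

namespace Guerra

section Deriv

variable {N k : ℕ} {S : Type*} [Fintype S] [Nonempty S] {Θ : Type*} [MeasurableSpace Θ]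
  {M : Measure (Mat N k)} {m : Fin (k + 1) → ℝ} {γ : Measure Θ} {ρ : Θ → ℝ}
  {K : Θ → S → Mat N k → ℝ} [IsProbabilityMeasure M] [IsProbabilityMeasure γ]

/-- The derivative of `totalWeight` in a direction `δ` seen only by the levels `r` with `c r ≠ 0`. -/
def totalWeightDeriv (M : Measure (Mat N k)) (m : Fin (k + 1) → ℝ) (K : S → Mat N k → ℝ)
    (c : Fin k → ℝ) (δ : S → ℝ) (σ : S) (z : Mat N k) : ℝ :=
  totalWeight M m K σ z * (δ σ - ∑ r : Fin k, (m r.succ - m r.castSucc) *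
    (c r * nestedDeriv M m K (fun τ _ => δ τ) r.castSucc z))

omit [Nonempty S] in
lemma Admissible.measurable_totalWeightDeriv (hK : Admissible ρ K) (c : Fin k → ℝ) (δ : S → ℝ)
    (σ : S) : Measurable fun p : Θ × Mat N k => totalWeightDeriv M m (K p.1) c δ σ p.2 := by
  have h1 := hK.measurable_totalWeight (M := M) (m := m) σ
  have h2 := fun r : Fin k => hK.measurable_nestedDeriv (M := M) (m := m)
    (admissible_const hK.nonneg δ) r.castSucc
  unfold totalWeightDeriv
  exact h1.mul (measurable_const.sub (Finset.measurable_sum _ fun r _ =>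
    ((h2 r).const_mul _).const_mul _))

lemma Admissible.expGrowth_totalWeightDeriv (hK : Admissible ρ K) (hM : SpliceInvariant M)
    (hm : ∀ l : Fin k, 0 < m l.succ) (c : Fin k → ℝ) (δ : S → ℝ) (σ : S) :
    ExpGrowth (fun p : Θ × Mat N k => ρ p.1 + ‖p.2‖)
      fun p => totalWeightDeriv M m (K p.1) c δ σ p.2 := by
  have hw := hK.nonneg_prod
  refine (hK.expGrowth_totalWeight hM hm σ).mul ?_
  simp only [sub_eq_add_neg, ← Finset.sum_neg_distrib]
  refine (ExpGrowth.const hw _).add hw (ExpGrowth.sum hw fun r _ => ?_)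
  refine (((ExpGrowth.const hw (m r.succ - m r.castSucc)).mul ((ExpGrowth.const hw (c r)).mul
    (hK.expGrowth_nestedDeriv (admissible_const hK.nonneg δ) hM hm r.castSucc)))).of_le fun p => ?_
  rw [abs_neg, sub_eq_add_neg]

lemma Admissible.integral_totalWeightDeriv (hK : Admissible ρ K) (hM : SpliceInvariant M)
    (hγ : ExpMoments ρ γ) (hm : ∀ l : Fin k, 0 < m l.succ) (c : Fin k → ℝ) (δ : S → ℝ) (σ : S) :
    ∫ p : Θ × Mat N k, totalWeightDeriv M m (K p.1) c δ σ p.2 ∂(γ.prod M) =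
      δ σ * (∫ p : Θ × Mat N k, totalWeight M m (K p.1) σ p.2 ∂(γ.prod M)) -
        ∑ r : Fin k, (m r.succ - m r.castSucc) * (c r * ∑ τ, δ τ * pairWeight γ M m K r σ τ) := by
  have h1 : Integrable (fun p : Θ × Mat N k => totalWeight M m (K p.1) σ p.2) (γ.prod M) :=
    hM.integrable_prod hγ (hK.expGrowth_totalWeight hM hm σ) (hK.measurable_totalWeight σ)
  have h2 : ∀ r : Fin k, Integrable (fun p : Θ × Mat N k => totalWeight M m (K p.1) σ p.2 *
      nestedDeriv M m (K p.1) (fun τ _ => δ τ) r.castSucc p.2) (γ.prod M) := fun r =>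
    hM.integrable_prod hγ ((hK.expGrowth_totalWeight hM hm σ).mul
      (hK.expGrowth_nestedDeriv (admissible_const hK.nonneg δ) hM hm r.castSucc))
      ((hK.measurable_totalWeight σ).mul
        (hK.measurable_nestedDeriv (admissible_const hK.nonneg δ) r.castSucc))
  have e : ∀ p : Θ × Mat N k, totalWeightDeriv M m (K p.1) c δ σ p.2 =
      δ σ * totalWeight M m (K p.1) σ p.2 - ∑ r : Fin k, (m r.succ - m r.castSucc) *
        (c r * (totalWeight M m (K p.1) σ p.2 *
          nestedDeriv M m (K p.1) (fun τ _ => δ τ) r.castSucc p.2)) := fun p => by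
    rw [totalWeightDeriv, mul_sub, Finset.mul_sum, mul_comm (δ σ)]
    congr 1
    exact Finset.sum_congr rfl fun r _ => by ring
  simp only [e]
  rw [integral_sub (h1.const_mul _) (integrable_finsetSum _ fun r _ =>
      ((h2 r).const_mul _).const_mul _),
    integral_finsetSum _ fun r _ => ((h2 r).const_mul _).const_mul _]
  simp only [integral_const_mul, hK.integral_totalWeight_mul_nestedDeriv hM hγ hm]

end Deriv

section Ham

variable {N k : ℕ}

/-- The Hamiltonian `a h(σ) + b s·σ`. -/
def ham (a b : ℝ) (h : SpinConfig N → ℝ) (σ : SpinConfig N) (z : Mat N k) : ℝ :=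
  a * h σ + b * ∑ i, (∑ l, z i l) * spin σ i

lemma abs_spin (σ : SpinConfig N) (i : Fin N) : |spin σ i| = 1 := by
  rcases Int.units_eq_one_or (σ i) with h | h <;> simp [spin, h]

lemma spin_mul_self (σ : SpinConfig N) (i : Fin N) : spin σ i * spin σ i = 1 := by
  rw [← abs_mul_abs_self, abs_spin, one_mul]

lemma overlap_self (hN : 1 ≤ N) (σ : SpinConfig N) : overlap σ σ = 1 := by
  have : (N : ℝ) ≠ 0 := by positivity
  simp [overlap, spin_mul_self, this]

lemma card_mul_overlap (hN : 1 ≤ N) (σ τ : SpinConfig N) :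
    N * overlap σ τ = ∑ i, spin σ i * spin τ i := by
  have : (N : ℝ) ≠ 0 := by positivity
  rw [overlap, mul_div_cancel₀ _ this]

lemma admissible_ham {Θ : Type*} [MeasurableSpace Θ] {ρ : Θ → ℝ} (hρ : ∀ θ, 0 ≤ ρ θ)
    {a b : Θ → ℝ} {g : Θ → SpinConfig N → ℝ} (ha : Measurable a) (hb : Measurable b)
    (hg : Measurable g) {B : ℝ} (ha' : ∀ θ, |a θ| ≤ B) (hb' : ∀ θ, |b θ| ≤ B)
    (hgρ : ∀ θ, ‖g θ‖ ≤ ρ θ) :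
    Admissible (N := N) (k := k) ρ fun θ => ham (a θ) (b θ) (g θ) where
  nonneg := hρ
  meas σ := by
    unfold ham
    have h1 : Measurable fun p : Θ × Mat N k => a p.1 * g p.1 σ :=
      (ha.comp measurable_fst).mul ((measurable_pi_apply σ).comp (hg.comp measurable_fst))
    have h2 : Measurable fun p : Θ × Mat N k => ∑ i, (∑ l, p.2 i l) * spin σ i := by fun_prop
    exact h1.add ((hb.comp measurable_fst).mul h2)
  growth σ := by
    have hw : ∀ p : Θ × Mat N k, 0 ≤ ρ p.1 + ‖p.2‖ := fun p => add_nonneg (hρ _) (norm_nonneg _)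
    unfold ham
    refine LinGrowth.add (LinGrowth.bdd_mul (c := fun p : Θ × Mat N k => a p.1) (fun p => ha' p.1) ?_)
      (LinGrowth.bdd_mul (c := fun p : Θ × Mat N k => b p.1) (fun p => hb' p.1) (LinGrowth.sum hw fun i _ => ?_))
    · refine (LinGrowth.self hw).of_le fun p => ?_
      rw [abs_of_nonneg (hw p)]
      have := (norm_le_pi_norm (g p.1) σ).trans (hgρ p.1)
      rw [Real.norm_eq_abs] at this
      linarith [norm_nonneg p.2]
    · simp only [mul_comm _ (spin σ i)]
      refine LinGrowth.const_mul _ (LinGrowth.sum hw fun l _ => (LinGrowth.self hw).of_le fun p => ?_)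
      rw [abs_of_nonneg (hw p)]
      have := (norm_le_pi_norm (p.2 i) l).trans (norm_le_pi_norm p.2 i)
      rw [Real.norm_eq_abs] at this
      linarith [hρ p.1]

lemma admissible_ham_const (a b : ℝ) :
    Admissible (N := N) (k := k) (fun h : SpinConfig N → ℝ => ‖h‖) fun h => ham a b h :=
  admissible_ham (a := fun _ => a) (b := fun _ => b) (g := id) (fun _ => norm_nonneg _)
    measurable_const measurable_const measurable_id (B := max |a| |b|)
    (fun _ => le_max_left _ _) (fun _ => le_max_right _ _) fun _ => le_rfl

/-- A Hamiltonian moving on a straight line. -/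
lemma admissible_line (a b : ℝ) (h : SpinConfig N → ℝ) (δ : SpinConfig N → ℝ) :
    Admissible (N := N) (k := k) (fun u : ℝ => |u|) fun u σ z => ham a b h σ z + u * δ σ where
  nonneg _ := abs_nonneg _
  meas σ := by
    have h0 : Measurable fun p : ℝ × Mat N k => (h, p.2) := by fun_prop
    have h1 := ((admissible_ham_const (N := N) (k := k) a b).meas σ).comp h0
    exact h1.add (measurable_fst.mul_const _)
  growth σ := by
    have hw : ∀ p : ℝ × Mat N k, 0 ≤ |p.1| + ‖p.2‖ := fun p =>
      add_nonneg (abs_nonneg _) (norm_nonneg _)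
    refine LinGrowth.add ?_ ?_
    · refine ((admissible_ham_const (N := N) (k := k) a b).growth σ).comp hw
        (φ := fun p : ℝ × Mat N k => (h, p.2)) ((LinGrowth.const hw ‖h‖).add
          ((LinGrowth.self hw).of_le fun p => ?_))
      rw [abs_of_nonneg (norm_nonneg _), abs_of_nonneg (hw p)]
      linarith [abs_nonneg p.1]
    · simp only [mul_comm _ (δ σ)]
      refine LinGrowth.const_mul _ ((LinGrowth.self hw).of_le fun p => ?_)
      rw [abs_of_nonneg (hw p)]
      linarith [norm_nonneg p.2]

variable {M : Measure (Mat N k)} {m : Fin (k + 1) → ℝ} [IsProbabilityMeasure M]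

lemma hasDerivAt_line (a b : ℝ) (h : SpinConfig N → ℝ) (δ : SpinConfig N → ℝ) (u : ℝ)
    (σ : SpinConfig N) (z : Mat N k) :
    HasDerivAt (fun u => ham a b h σ z + u * δ σ) (δ σ) u := by
  simpa using ((hasDerivAt_id u).mul_const (δ σ)).const_add (ham a b h σ z)

/-- The Hamiltonian is linear in `h`, and no `E_l` averages over `h`; a shift of `h` is therefore
felt at every level, whence the coefficients `1`. -/
lemma hasDerivAt_totalWeight_add_left (hM : SpliceInvariant M) (hm : ∀ l : Fin k, 0 < m l.succ)
    (a b : ℝ) (h v : SpinConfig N → ℝ) (σ : SpinConfig N) (z : Mat N k) :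
    HasDerivAt (fun u : ℝ => totalWeight M m (ham a b (h + u • v)) σ z)
      (totalWeightDeriv M m (ham a b h) (fun _ => 1) (fun τ => a * v τ) σ z) 0 := by
  have key := hasDerivAt_totalWeight (admissible_line a b h fun τ => a * v τ)
    (admissible_const (fun _ => abs_nonneg _) fun τ => a * v τ) hM hm
    (hasDerivAt_line a b h fun τ => a * v τ) 0 σ z
  have e : ∀ u : ℝ, (fun σ z => ham a b h σ z + u * (a * v σ) : SpinConfig N → Mat N k → ℝ) =
      ham a b (h + u • v) := fun u => by
    ext σ z
    simp [ham]
    ring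
  have e0 : ham a b (h + (0 : ℝ) • v) = (ham a b h : SpinConfig N → Mat N k → ℝ) := by simp
  simp only [e, e0] at key
  simpa only [totalWeightDeriv, one_mul] using key

/-- A shift of column `j` is felt at level `r.castSucc` exactly when that column has not been
averaged out there, that is when `j ≤ r.castSucc`. In that case `nested_add` turns it into a shift
of the Hamiltonian, which is linear in `z`. -/
lemma hasDerivAt_totalWeight_add_right (hM : SpliceInvariant M) (hm : ∀ l : Fin k, 0 < m l.succ)
    (a b : ℝ) (h : SpinConfig N → ℝ) (j : Fin (k + 1)) (x : Fin N → ℝ) (σ : SpinConfig N)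
    (z : Mat N k) :
    HasDerivAt (fun u : ℝ => totalWeight M m (ham a b h) σ
        (z + u • (fun i p => if p = j then x i else 0 : Mat N k)))
      (totalWeightDeriv M m (ham a b h) (fun r => if j ≤ r.castSucc then 1 else 0)
        (fun τ => b * ∑ i, x i * spin τ i) σ z) 0 := by
  set e : Mat N k := fun i p => if p = j then x i else 0 with he
  set δ : SpinConfig N → ℝ := fun τ => b * ∑ i, x i * spin τ i with hδ
  have hline : ∀ u : ℝ, (fun σ z => ham a b h σ (z + u • e) : SpinConfig N → Mat N k → ℝ) =
      fun σ z => ham a b h σ z + u * δ σ := fun u => by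
    ext σ z
    simp only [ham, he, hδ, Pi.add_apply, Pi.smul_apply, smul_eq_mul, Finset.sum_add_distrib,
      add_mul, mul_ite, mul_zero, Finset.sum_ite_eq', Finset.mem_univ, if_true, mul_add,
      add_assoc]
    rw [mul_left_comm u b, Finset.mul_sum (a := u)]
    simp only [mul_assoc]
  have hder := hasDerivAt_nested (admissible_line (k := k) a b h δ)
    (admissible_const (fun _ => abs_nonneg _) δ) hM hm (hasDerivAt_line a b h δ)
  have h0 : (fun σ z => ham a b h σ z + 0 * δ σ : SpinConfig N → Mat N k → ℝ) = ham a b h := by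
    simp
  have hr : ∀ r : Fin k, HasDerivAt (fun u : ℝ => nested M m (ham a b h) r.castSucc (z + u • e))
      ((if j ≤ r.castSucc then 1 else 0) *
        nestedDeriv M m (ham a b h) (fun τ _ => δ τ) r.castSucc z) 0 := by
    intro r
    split_ifs with hj
    · have h1 := hder r.castSucc 0 z
      rw [h0] at h1
      rw [one_mul]
      refine h1.congr_of_eventuallyEq (Filter.Eventually.of_forall fun u => ?_)
      simp only
      rw [← hline, nested_add]
      intro i p hp
      simp [he, (hj.trans_lt hp).ne']
    · rw [zero_mul]
      refine (hasDerivAt_const (0 : ℝ) (nested M m (ham a b h) r.castSucc z)).congr_of_eventuallyEq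
        (Filter.Eventually.of_forall fun u => ?_)
      refine nested_castSucc_congr M m _ r fun i p hp => ?_
      have : p ≠ j := fun hpj => hj (Fin.le_castSucc_iff.2 (hpj ▸ hp))
      simp [he, this]
  have hH : HasDerivAt (fun u : ℝ => ham a b h σ (z + u • e)) (δ σ) 0 := by
    refine (hasDerivAt_line a b h δ 0 σ z).congr_of_eventuallyEq
      (Filter.Eventually.of_forall fun u => ?_)
    exact congrFun (congrFun (hline u) σ) z
  have key := (hH.sub (HasDerivAt.fun_sum (u := Finset.univ) fun r _ =>
    (hr r).const_mul (m (Fin.succ r) - m (Fin.castSucc r)))).exp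
  simpa [totalWeightDeriv, totalWeight] using key

end Ham

end Guerra

end

/-! ### Integration by parts in the variables `H_N` and in the columns of `Z`. -/

noncomputable section

namespace Guerra

section Ibp

variable {ι : Type*} [Fintype ι] {N k : ℕ}

/-- Reduces the conditions on means and covariances, stated for all linear forms in
`integral_mul_of_isGaussian`, to conditions on coordinates. -/
lemma strongDual_prod_apply (L : StrongDual ℝ ((ι → ℝ) × Mat N k)) :
    ∃ (α : ι → ℝ) (β : Fin N → Fin (k + 1) → ℝ), ∀ p : (ι → ℝ) × Mat N k,
      L p = ∑ σ, p.1 σ * α σ + ∑ i, ∑ j, p.2 i j * β i j := by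
  classical
  refine ⟨fun σ => L (Pi.single σ 1, 0), fun i j => L (0, Pi.single i (Pi.single j 1)), fun p => ?_⟩
  have h1 : p.1 = ∑ σ, p.1 σ • (Pi.single σ 1 : ι → ℝ) := by
    ext σ
    simp [Finset.sum_apply, Pi.single_apply]
  have h2 : p.2 = ∑ i, ∑ j, p.2 i j • (Pi.single i (Pi.single j 1) : Mat N k) := by
    ext i j
    simp only [Finset.sum_apply, Pi.smul_apply, smul_eq_mul]
    rw [Finset.sum_eq_single i (fun i' _ hi' => by simp [Pi.single_eq_of_ne hi'.symm]) (by simp),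
      Finset.sum_eq_single j (fun j' _ hj' => by simp [Pi.single_eq_of_ne hj'.symm]) (by simp)]
    simp
  have e : L p = (L.comp (ContinuousLinearMap.inl ℝ (ι → ℝ) (Mat N k))) p.1 +
      (L.comp (ContinuousLinearMap.inr ℝ (ι → ℝ) (Mat N k))) p.2 := by
    simp [← map_add]
  rw [e]
  conv_lhs => rw [h1, h2]
  simp only [map_sum, map_smul, smul_eq_mul]
  rfl

variable {γ : Measure (ι → ℝ)} [IsGaussian γ] {M : Measure (Mat N k)} [IsGaussian M]

/-- Gaussian integration by parts for the product of two centred Gaussian measures. -/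
lemma integral_mul_prod_gaussian (hγ : ∀ σ, ∫ h, h σ ∂γ = 0) (hM : ∀ i j, ∫ z, z i j ∂M = 0)
    (L : StrongDual ℝ ((ι → ℝ) × Mat N k)) (c : (ι → ℝ) × Mat N k)
    (hc₁ : ∀ σ, ∫ p, L p * p.1 σ ∂(γ.prod M) = c.1 σ)
    (hc₂ : ∀ i j, ∫ p, L p * p.2 i j ∂(γ.prod M) = c.2 i j)
    {f f' : (ι → ℝ) × Mat N k → ℝ} (hfm : Measurable f) (hfm' : Measurable f')
    (hfg : ExpGrowth (fun p => ‖p.1‖ + ‖p.2‖) f) (hfg' : ExpGrowth (fun p => ‖p.1‖ + ‖p.2‖) f')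
    (hf : ∀ p, HasDerivAt (fun u : ℝ => f (p + u • c)) (f' p) 0) :
    ∫ p, L p * f p ∂(γ.prod M) = ∫ p, f' p ∂(γ.prod M) := by
  have hL2 : ∀ L' : StrongDual ℝ ((ι → ℝ) × Mat N k), MemLp (fun p => L' p) 2 (γ.prod M) :=
    fun L' => L'.comp_memLp' (IsGaussian.memLp_id _ 2 (by simp))
  have hw : ∀ p : (ι → ℝ) × Mat N k, 0 ≤ ‖p.1‖ + ‖p.2‖ := fun p => by positivity
  have hmom : ExpMoments (fun p : (ι → ℝ) × Mat N k => ‖p.1‖ + ‖p.2‖) (γ.prod M) :=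
    (expMoments_norm γ).prod (expMoments_norm M)
  set P₁ : ι → StrongDual ℝ ((ι → ℝ) × Mat N k) := fun σ =>
    (ContinuousLinearMap.proj σ).comp (ContinuousLinearMap.fst ℝ (ι → ℝ) (Mat N k)) with hP₁
  set P₂ : Fin N → Fin (k + 1) → StrongDual ℝ ((ι → ℝ) × Mat N k) := fun i j =>
    ((ContinuousLinearMap.proj (R := ℝ) (φ := fun _ : Fin (k + 1) => ℝ) j).comp
      (ContinuousLinearMap.proj (R := ℝ) (φ := fun _ : Fin N => Fin (k + 1) → ℝ) i)).comp
        (ContinuousLinearMap.snd ℝ (ι → ℝ) (Mat N k)) with hP₂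
  have i1 : ∀ σ, Integrable (fun p : (ι → ℝ) × Mat N k => p.1 σ) (γ.prod M) := fun σ =>
    (hL2 (P₁ σ)).integrable (by simp)
  have i2 : ∀ i j, Integrable (fun p : (ι → ℝ) × Mat N k => p.2 i j) (γ.prod M) := fun i j =>
    (hL2 (P₂ i j)).integrable (by simp)
  have i1' : ∀ σ, Integrable (fun p : (ι → ℝ) × Mat N k => L p * p.1 σ) (γ.prod M) := fun σ =>
    (hL2 L).integrable_mul (hL2 (P₁ σ))
  have i2' : ∀ i j, Integrable (fun p : (ι → ℝ) × Mat N k => L p * p.2 i j) (γ.prod M) :=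
    fun i j => (hL2 L).integrable_mul (hL2 (P₂ i j))
  refine integral_mul_of_isGaussian L (fun L' => ?_) c (fun L' => ?_) hfm hfm' hf
    (hfg.integrable hfm.aestronglyMeasurable hmom) (hfg'.integrable hfm'.aestronglyMeasurable hmom)
    (ExpGrowth.integrable (w := fun p => ‖p.1‖ + ‖p.2‖) (ExpGrowth.mul (LinGrowth.expGrowth ?_) hfg)
      (L.continuous.measurable.mul hfm).aestronglyMeasurable hmom)
  · obtain ⟨α, β, hL'⟩ := strongDual_prod_apply L'
    have e1 : ∀ σ, ∫ p : (ι → ℝ) × Mat N k, p.1 σ ∂(γ.prod M) = 0 := fun σ => by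
      rw [integral_prod _ (i1 σ)]
      simpa using hγ σ
    have e2 : ∀ i j, ∫ p : (ι → ℝ) × Mat N k, p.2 i j ∂(γ.prod M) = 0 := fun i j => by
      rw [integral_prod _ (i2 i j)]
      simp [hM i j]
    simp only [hL']
    rw [integral_add (integrable_finsetSum _ fun σ _ => (i1 σ).mul_const _)
      (integrable_finsetSum _ fun i _ => integrable_finsetSum _ fun j _ => (i2 i j).mul_const _),
      integral_finsetSum _ fun σ _ => (i1 σ).mul_const _,
      integral_finsetSum _ fun i _ => integrable_finsetSum _ fun j _ => (i2 i j).mul_const _]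
    simp only [integral_finsetSum _ fun j _ => (i2 _ j).mul_const _, integral_mul_const, e1, e2]
    simp
  · obtain ⟨α, β, hL'⟩ := strongDual_prod_apply L'
    have e : ∀ p : (ι → ℝ) × Mat N k, L p * L' p =
        ∑ σ, L p * p.1 σ * α σ + ∑ i, ∑ j, L p * p.2 i j * β i j := fun p => by
      simp only [hL' p, mul_add, Finset.mul_sum, mul_assoc]
    simp only [e]
    rw [integral_add (integrable_finsetSum _ fun σ _ => (i1' σ).mul_const _)
      (integrable_finsetSum _ fun i _ => integrable_finsetSum _ fun j _ => (i2' i j).mul_const _),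
      integral_finsetSum _ fun σ _ => (i1' σ).mul_const _,
      integral_finsetSum _ fun i _ => integrable_finsetSum _ fun j _ => (i2' i j).mul_const _]
    simp only [integral_finsetSum _ fun j _ => (i2' _ j).mul_const _, integral_mul_const, hc₁, hc₂]
    exact (hL' c).symm
  · refine ((LinGrowth.self hw).const_mul ‖L‖).of_le fun p => ?_
    rw [abs_of_nonneg (mul_nonneg (norm_nonneg _) (hw p))]
    refine (L.le_opNorm p).trans (mul_le_mul_of_nonneg_left ?_ (norm_nonneg _))
    rw [Prod.norm_def]
    exact max_le_add_of_nonneg (norm_nonneg _) (norm_nonneg _)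

end Ibp

section HamIbp

variable {N k : ℕ} {m : Fin (k + 1) → ℝ} {ξ : ℝ → ℝ} {q : Fin (k + 2) → ℝ}
  {γ : Measure (SpinConfig N → ℝ)} [IsGaussian γ]

/-- Integration by parts in the variables `H_N`. -/
lemma integral_field_mul_totalWeight (hγ : ∀ σ, ∫ h, h σ ∂γ = 0)
    {C : SpinConfig N → SpinConfig N → ℝ} (hC : ∀ σ τ, ∫ h, h σ * h τ ∂γ = C σ τ)
    (hm : ∀ l : Fin k, 0 < m l.succ) (a b : ℝ) (σ : SpinConfig N) :
    ∫ p, p.1 σ * totalWeight (matLaw ξ N q) m (ham a b p.1) σ p.2 ∂(γ.prod (matLaw ξ N q)) =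
      a * C σ σ * (∫ p, totalWeight (matLaw ξ N q) m (ham a b p.1) σ p.2 ∂(γ.prod (matLaw ξ N q))) -
        ∑ r : Fin k, (m r.succ - m r.castSucc) * ∑ τ, a * C σ τ *
          pairWeight γ (matLaw ξ N q) m (ham a b) r σ τ := by
  have hM := spliceInvariant_matLaw ξ N q
  have hK := admissible_ham_const (N := N) (k := k) a b
  have hγe := expMoments_norm γ
  have h := integral_mul_prod_gaussian hγ (integral_matLaw_entry ξ N q)
    ((ContinuousLinearMap.proj σ).comp
      (ContinuousLinearMap.fst ℝ (SpinConfig N → ℝ) (Mat N k))) (C σ, 0)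
    (f := fun p => totalWeight (matLaw ξ N q) m (ham a b p.1) σ p.2)
    (f' := fun p => totalWeightDeriv (matLaw ξ N q) m (ham a b p.1) (fun _ => 1)
      (fun τ => a * C σ τ) σ p.2) ?_ ?_
    (hK.measurable_totalWeight σ) (hK.measurable_totalWeightDeriv _ _ _)
    (hK.expGrowth_totalWeight hM hm σ) (hK.expGrowth_totalWeightDeriv hM hm _ _ _)
    (fun p => by
      simpa using hasDerivAt_totalWeight_add_left hM hm a b p.1 (C σ) σ p.2)
  · rw [hK.integral_totalWeightDeriv hM hγe hm] at h
    simp only [one_mul] at h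
    exact h
  · intro τ
    have := integral_prod_mul (μ := γ) (ν := matLaw ξ N q) (fun h => h σ * h τ) (fun _ => (1 : ℝ))
    simpa [hC] using this
  · intro i j
    have := integral_prod_mul (μ := γ) (ν := matLaw ξ N q) (fun h => h σ) (fun z => z i j)
    simpa [hγ] using this

/-- Integration by parts in the column `j` of `Z`. -/
lemma integral_column_mul_totalWeight (hN : 1 ≤ N) (hγ : ∀ σ, ∫ h, h σ ∂γ = 0)
    (hq : ∀ l : Fin (k + 1), deriv ξ (q l.castSucc) ≤ deriv ξ (q l.succ))
    (hm : ∀ l : Fin k, 0 < m l.succ) (a b : ℝ) (j : Fin (k + 1)) (σ : SpinConfig N) :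
    ∫ p, (∑ i, p.2 i j * spin σ i) * totalWeight (matLaw ξ N q) m (ham a b p.1) σ p.2
        ∂(γ.prod (matLaw ξ N q)) =
      (deriv ξ (q j.succ) - deriv ξ (q j.castSucc)) * (b * N *
        (∫ p, totalWeight (matLaw ξ N q) m (ham a b p.1) σ p.2 ∂(γ.prod (matLaw ξ N q)))) -
        ∑ r : Fin k, (m r.succ - m r.castSucc) *
          ((if j ≤ r.castSucc then deriv ξ (q j.succ) - deriv ξ (q j.castSucc) else 0) *
            ∑ τ, b * N * overlap σ τ * pairWeight γ (matLaw ξ N q) m (ham a b) r σ τ) := by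
  have hM := spliceInvariant_matLaw ξ N q
  have hK := admissible_ham_const (N := N) (k := k) a b
  have hγe := expMoments_norm γ
  set D := deriv ξ (q j.succ) - deriv ξ (q j.castSucc) with hD
  set L : StrongDual ℝ ((SpinConfig N → ℝ) × Mat N k) := ∑ i, spin σ i •
    ((ContinuousLinearMap.proj (R := ℝ) (φ := fun _ : Fin (k + 1) => ℝ) j).comp
      (ContinuousLinearMap.proj (R := ℝ) (φ := fun _ : Fin N => Fin (k + 1) → ℝ) i)).comp
        (ContinuousLinearMap.snd ℝ (SpinConfig N → ℝ) (Mat N k)) with hL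
  have hLp : ∀ p, L p = ∑ i, p.2 i j * spin σ i := fun p => by
    simp [hL, mul_comm]
  have hδ : ∀ τ, b * ∑ i, D * spin σ i * spin τ i = D * (b * N * overlap σ τ) := fun τ => by
    rw [mul_assoc b, card_mul_overlap hN]
    simp only [mul_assoc, ← Finset.mul_sum]
    ring
  have h := integral_mul_prod_gaussian hγ (integral_matLaw_entry ξ N q) L
    -- The covariances of `∑ i, z_{ij} σ_i` with the coordinates: only column `j` correlates, with
    -- variance `D` per entry.
    (0, fun i p => if p = j then D * spin σ i else 0)
    (f := fun p => totalWeight (matLaw ξ N q) m (ham a b p.1) σ p.2)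
    (f' := fun p => totalWeightDeriv (matLaw ξ N q) m (ham a b p.1)
      (fun r => if j ≤ r.castSucc then 1 else 0)
      (fun τ => b * ∑ i, D * spin σ i * spin τ i) σ p.2) ?_ ?_
    (hK.measurable_totalWeight σ) (hK.measurable_totalWeightDeriv _ _ _)
    (hK.expGrowth_totalWeight hM hm σ) (hK.expGrowth_totalWeightDeriv hM hm _ _ _)
    (fun p => by
      simpa using hasDerivAt_totalWeight_add_right hM hm a b p.1 j (fun i => D * spin σ i) σ p.2)
  · rw [hK.integral_totalWeightDeriv hM hγe hm] at h
    simp only [hLp, hδ, overlap_self hN, mul_one] at h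
    rw [h]
    congr 1
    · ring
    · refine Finset.sum_congr rfl fun r _ => ?_
      congr 1
      split_ifs with hj
      · rw [one_mul, Finset.mul_sum]
        exact Finset.sum_congr rfl fun τ _ => by ring
      · simp
  · intro τ
    have hz := integral_prod_mul (μ := γ) (ν := matLaw ξ N q) (fun h => h τ)
      (fun z => ∑ i, z i j * spin σ i)
    rw [hγ, zero_mul] at hz
    simp only [hLp]
    simpa only [mul_comm, Pi.zero_apply] using hz
  · intro i' j'
    have hint : ∀ i, Integrable (fun z : Mat N k => z i j * z i' j') (matLaw ξ N q) := fun i => by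
      have hc : ∀ i j, LinGrowth (fun z : Mat N k => ‖z‖) (fun z => z i j) := fun i j =>
        (LinGrowth.self fun z => norm_nonneg z).of_le fun z => by
          rw [abs_norm]
          exact (norm_le_pi_norm (z i) j).trans (norm_le_pi_norm z i)
      exact ((hc i j).expGrowth.mul (hc i' j').expGrowth).integrable
        (show Measurable fun z : Mat N k => z i j * z i' j' by fun_prop).aestronglyMeasurable
        hM.moments
    have := integral_prod_mul (μ := γ) (ν := matLaw ξ N q) (fun _ => (1 : ℝ))
      (fun z => (∑ i, z i j * spin σ i) * z i' j')
    simp only [one_mul, integral_const, probReal_univ, smul_eq_mul] at this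
    simp only [hLp]
    rw [this]
    have e : ∀ z : Mat N k, (∑ i, z i j * spin σ i) * z i' j' =
        ∑ i, spin σ i * (z i j * z i' j') := fun z => by
      rw [Finset.sum_mul]
      exact Finset.sum_congr rfl fun i _ => by ring
    simp only [e]
    rw [integral_finsetSum _ fun i _ => (hint i).const_mul _]
    simp only [integral_const_mul, integral_matLaw_entry_mul N hq]
    rw [Finset.sum_eq_single i' (fun i _ hi => by simp [hi]) (by simp)]
    by_cases hj : j = j'
    · subst hj
      simp [hD, mul_comm]
    · simp [hj, Ne.symm hj]

end HamIbp

end Guerra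

end

/-! ### The derivative along the rotation `(sin s, cos s)`. -/

noncomputable section

namespace Guerra

section Calculus

/-- At an endpoint a continuous function whose derivative has a limit is one-sidedly differentiable
with that limit as derivative. -/
lemma hasDerivWithinAt_Icc_of_continuous {f f' : ℝ → ℝ} (hf : Continuous f) (hf' : Continuous f')
    (hd : ∀ t ∈ Set.Ioo (0 : ℝ) 1, HasDerivAt f (f' t) t) {t : ℝ} (ht : t ∈ Set.Icc (0 : ℝ) 1) :
    HasDerivWithinAt f (f' t) (Set.Icc 0 1) t := by
  have hdiff : DifferentiableOn ℝ f (Set.Ioo 0 1) := fun t ht =>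
    (hd t ht).differentiableAt.differentiableWithinAt
  rcases ht.1.eq_or_lt with rfl | h0
  · have hn : Set.Ioo (0 : ℝ) 1 ∈ nhdsWithin 0 (Set.Ioi 0) := Ioo_mem_nhdsGT one_pos
    refine (hasDerivWithinAt_Ici_of_tendsto_deriv hdiff hf.continuousWithinAt hn
      ((hf'.continuousWithinAt (s := Set.Ioi 0)).congr' ?_)).mono Set.Icc_subset_Ici_self
    filter_upwards [hn] with t ht using (hd t ht).deriv.symm
  rcases ht.2.eq_or_lt with rfl | h1
  · have hn : Set.Ioo (0 : ℝ) 1 ∈ nhdsWithin 1 (Set.Iio 1) := Ioo_mem_nhdsLT one_pos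
    refine (hasDerivWithinAt_Iic_of_tendsto_deriv hdiff hf.continuousWithinAt hn
      ((hf'.continuousWithinAt (s := Set.Iio 1)).congr' ?_)).mono Set.Icc_subset_Iic_self
    filter_upwards [hn] with t ht using (hd t ht).deriv.symm
  · exact (hd t ⟨h0, h1⟩).hasDerivWithinAt

lemma sum_ite_le_sub {k : ℕ} (g : Fin (k + 2) → ℝ) (r : Fin k) :
    ∑ j : Fin (k + 1), (if j ≤ r.castSucc then g j.succ - g j.castSucc else 0) =
      g r.succ.castSucc - g 0 := by
  -- Freezing `g` beyond the index `r + 1` makes the increments with `j > r` vanish, so the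
  -- truncated sum is a full telescoping sum.
  have h := sum_succ_sub_castSucc fun l : Fin (k + 2) => g (min l r.succ.castSucc)
  rw [min_eq_right (Fin.le_last _), min_eq_left (Fin.zero_le _)] at h
  rw [← h]
  refine Finset.sum_congr rfl fun j _ => ?_
  split_ifs with hj
  · rw [min_eq_left, min_eq_left]
    · simp only [Fin.le_def, Fin.val_castSucc, Fin.val_succ] at hj ⊢
      omega
    · simp only [Fin.le_def, Fin.val_castSucc, Fin.val_succ] at hj ⊢
      omega
  · rw [min_eq_right, min_eq_right, sub_self]
    · simp only [Fin.le_def, Fin.val_castSucc, Fin.val_succ] at hj ⊢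
      omega
    · simp only [Fin.le_def, Fin.val_castSucc, Fin.val_succ] at hj ⊢
      omega

end Calculus

section Interpolation

variable {N k : ℕ} {m : Fin (k + 1) → ℝ} {ξ : ℝ → ℝ} {q : Fin (k + 2) → ℝ}

/-- The first replica carries all the weights `W_l`, hence `totalWeight`; the second only those with
`l ≥ r`, hence `tailWeight`. -/
lemma muIntegrand_eq (hm_zero : m 0 = 0) (hm_last : m (Fin.last k) = 1) (t : ℝ) (r : Fin k)
    (f : SpinConfig N → SpinConfig N → ℝ) (h : SpinConfig N → ℝ) (z₁ z₂ : Mat N k) :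
    muIntegrand ξ m q t r f h z₁ z₂ = ∑ σ, ∑ τ, f σ τ *
      (totalWeight (matLaw ξ N q) m (ham (√t) (√(1 - t)) h) σ z₁ *
        tailWeight (matLaw ξ N q) m (ham (√t) (√(1 - t)) h) r τ z₂) := by
  set K : SpinConfig N → Mat N k → ℝ := ham (√t) (√(1 - t)) h with hK
  -- `X` is by definition the general recursion `nested` for this Hamiltonian and the law `matLaw`.
  have hW : ∀ l z, W ξ m q t h l z = tilt (matLaw ξ N q) m K l z := fun _ _ => rfl
  have hg : gibbs t h z₁ z₂ f = ∑ σ, ∑ τ, f σ τ *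
      ((Real.exp (K σ z₁) / ∑ σ', Real.exp (K σ' z₁)) *
        (Real.exp (K τ z₂) / ∑ τ', Real.exp (K τ' z₂))) := by
    have hH : ∀ σ z, interpHam t h z σ = K σ z := fun _ _ => rfl
    simp only [gibbs, hH, Real.exp_add, ← Finset.mul_sum, ← Finset.sum_mul]
    simp only [Finset.sum_div]
    refine Finset.sum_congr rfl fun σ _ => Finset.sum_congr rfl fun τ _ => ?_
    rw [div_mul_div_comm, mul_div_assoc]
  have hp : (∏ l ∈ Finset.univ.filter (fun l => l < r), W ξ m q t h l z₁) *
      (∏ l ∈ Finset.univ.filter (fun l => r ≤ l), W ξ m q t h l z₁ * W ξ m q t h l z₂) =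
      (∏ l, tilt (matLaw ξ N q) m K l z₁) *
        ∏ l ∈ Finset.univ.filter (fun l => r ≤ l), tilt (matLaw ξ N q) m K l z₂ := by
    simp only [hW, Finset.prod_mul_distrib]
    rw [← mul_assoc, ← Finset.prod_filter_mul_prod_filter_not Finset.univ (fun l => l < r)
      (fun l => tilt (matLaw ξ N q) m K l z₁)]
    simp only [not_lt]
  rw [muIntegrand, hp, hg, Finset.mul_sum]
  refine Finset.sum_congr rfl fun σ _ => ?_
  rw [Finset.mul_sum]
  refine Finset.sum_congr rfl fun τ _ => ?_
  rw [← prod_tilt_mul_gibbs hm_zero hm_last, tailWeight]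
  ring

variable {γ : Measure (SpinConfig N → ℝ)} [IsGaussian γ]

/-- The right hand side of the formula for the derivative, in terms of the parameter `s` such that
`√t = sin s` and `√(1 - t) = cos s`. -/
def derivFormula (γ : Measure (SpinConfig N → ℝ)) (ξ : ℝ → ℝ) (m : Fin (k + 1) → ℝ)
    (q : Fin (k + 2) → ℝ) (s : ℝ) : ℝ :=
  -(1 / 2) * theta ξ 1 + (1 / 2) * ∑ r : Fin k,
      (m r.succ - m r.castSucc) * theta ξ (q r.succ.castSucc)
    - (1 / 2) * ∑ r : Fin k, (m r.succ - m r.castSucc) * ∑ σ, ∑ τ,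
      Delta ξ (overlap σ τ) (q r.succ.castSucc) *
        pairWeight γ (matLaw ξ N q) m (ham (Real.sin s) (Real.cos s)) r σ τ

lemma admissible_rotation : Admissible (N := N) (k := k)
    (fun p : ℝ × (SpinConfig N → ℝ) => ‖p.2‖)
    (fun p => ham (Real.sin p.1) (Real.cos p.1) p.2) :=
  admissible_ham (a := fun p : ℝ × (SpinConfig N → ℝ) => Real.sin p.1)
    (b := fun p => Real.cos p.1) (g := fun p => p.2) (fun _ => norm_nonneg _)
    (Real.measurable_sin.comp measurable_fst) (Real.measurable_cos.comp measurable_fst)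
    measurable_snd (B := 1) (fun _ => Real.abs_sin_le_one _) (fun _ => Real.abs_cos_le_one _)
    fun _ => le_rfl

lemma admissible_rotation_deriv : Admissible (N := N) (k := k)
    (fun p : ℝ × (SpinConfig N → ℝ) => ‖p.2‖)
    (fun p => ham (Real.cos p.1) (-Real.sin p.1) p.2) :=
  admissible_ham (a := fun p : ℝ × (SpinConfig N → ℝ) => Real.cos p.1)
    (b := fun p => -Real.sin p.1) (g := fun p => p.2) (fun _ => norm_nonneg _)
    (Real.measurable_cos.comp measurable_fst) (Real.measurable_sin.comp measurable_fst).neg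
    measurable_snd (B := 1) (fun _ => Real.abs_cos_le_one _)
    (fun _ => by rw [abs_neg]; exact Real.abs_sin_le_one _) fun _ => le_rfl

lemma hasDerivAt_rotation (h : SpinConfig N → ℝ) (u : ℝ) (σ : SpinConfig N) (z : Mat N k) :
    HasDerivAt (fun u => ham (Real.sin u) (Real.cos u) h σ z)
      (ham (Real.cos u) (-Real.sin u) h σ z) u :=
  ((Real.hasDerivAt_sin u).mul_const _).add ((Real.hasDerivAt_cos u).mul_const _)

lemma continuous_derivFormula (hm : ∀ l : Fin k, 0 < m l.succ) :
    Continuous (derivFormula γ ξ m q) := by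
  have h := fun (r : Fin k) (σ τ : SpinConfig N) => continuous_pairWeight (γ := γ)
    (M := matLaw ξ N q) (m := m) (ρ := fun h : SpinConfig N → ℝ => ‖h‖) admissible_rotation
    admissible_rotation_deriv hasDerivAt_rotation (spliceInvariant_matLaw ξ N q)
    (expMoments_norm γ) hm r σ τ
  unfold derivFormula
  exact continuous_const.sub (continuous_const.mul (continuous_finsetSum _ fun r _ =>
    continuous_const.mul (continuous_finsetSum _ fun σ _ => continuous_finsetSum _ fun τ _ =>
      continuous_const.mul (h r σ τ))))

lemma hasDerivAt_rotation_integral (hN : 1 ≤ N) (hk : 1 ≤ k) (hγ : ∀ σ, ∫ h, h σ ∂γ = 0)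
    (hC : ∀ σ τ, ∫ h, h σ * h τ ∂γ = N * ξ (overlap σ τ))
    (hq : ∀ l : Fin (k + 1), deriv ξ (q l.castSucc) ≤ deriv ξ (q l.succ))
    (hξ : deriv ξ 0 = 0) (hq_zero : q 0 = 0) (hq_last : q (Fin.last (k + 1)) = 1)
    (hm : ∀ l : Fin k, 0 < m l.succ) (hm_zero : m 0 = 0) (hm_last : m (Fin.last k) = 1) (s : ℝ) :
    HasDerivAt (fun s => ∫ p : (SpinConfig N → ℝ) × Mat N k, nested (matLaw ξ N q) m
        (ham (Real.sin s) (Real.cos s) p.1) 0 p.2 ∂(γ.prod (matLaw ξ N q)))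
      (N * (2 * Real.sin s * Real.cos s * derivFormula γ ξ m q s)) s := by
  have hM := spliceInvariant_matLaw ξ N q
  have hγe := expMoments_norm γ
  have hK := (admissible_rotation (N := N) (k := k)).slice (ρ := fun h => ‖h‖) s
  have hd := (admissible_rotation_deriv (N := N) (k := k)).slice (ρ := fun h => ‖h‖) s
  refine (hasDerivAt_integral_nested (γ := γ) (ρ := fun h : SpinConfig N → ℝ => ‖h‖)
    admissible_rotation admissible_rotation_deriv hasDerivAt_rotation hM hγe hm 0 s).congr_deriv ?_
  rw [hK.integral_nestedDeriv_zero hd hM hγe hm hm_zero hm_last hk]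
  set A : SpinConfig N → ℝ := fun σ => ∫ p, totalWeight (matLaw ξ N q) m
    (ham (Real.sin s) (Real.cos s) p.1) σ p.2 ∂(γ.prod (matLaw ξ N q)) with hA
  set G : Fin k → SpinConfig N → SpinConfig N → ℝ := fun r σ τ =>
    pairWeight γ (matLaw ξ N q) m (ham (Real.sin s) (Real.cos s)) r σ τ with hG
  have hA1 : ∑ σ, A σ = 1 := hK.sum_integral_totalWeight hM hγe hm hm_zero hm_last hk
  have hG1 : ∀ r σ, ∑ τ, G r σ τ = A σ := hK.sum_pairWeight hM hγe hm
  have hfield := integral_field_mul_totalWeight (ξ := ξ) (q := q) (m := m) hγ hC hm (Real.sin s)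
    (Real.cos s)
  have hcol := integral_column_mul_totalWeight (q := q) (m := m) hN hγ hq hm (Real.sin s)
    (Real.cos s)
  have hdq : ∑ j : Fin (k + 1), (deriv ξ (q j.succ) - deriv ξ (q j.castSucc)) = deriv ξ 1 := by
    rw [sum_succ_sub_castSucc fun l => deriv ξ (q l), hq_last, hq_zero, hξ, sub_zero]
  have hdq' : ∀ r : Fin k, ∑ j : Fin (k + 1), (if j ≤ r.castSucc then
      deriv ξ (q j.succ) - deriv ξ (q j.castSucc) else 0) = deriv ξ (q r.succ.castSucc) := fun r => by
    rw [sum_ite_le_sub (fun l => deriv ξ (q l)) r, hq_zero, hξ, sub_zero]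
  have hT := fun σ => hK.expGrowth_totalWeight hM hm σ
  have hTm := fun σ => hK.measurable_totalWeight (M := matLaw ξ N q) (m := m) σ
  have i1 : ∀ σ, Integrable (fun p : (SpinConfig N → ℝ) × Mat N k => p.1 σ *
      totalWeight (matLaw ξ N q) m (ham (Real.sin s) (Real.cos s) p.1) σ p.2)
      (γ.prod (matLaw ξ N q)) := fun σ => by
    refine hM.integrable_prod hγe (ExpGrowth.mul (LinGrowth.expGrowth
      ((LinGrowth.self hK.nonneg_prod).of_le fun p => ?_)) (hT σ))
      (((measurable_pi_apply σ).comp measurable_fst).mul (hTm σ))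
    rw [abs_of_nonneg (hK.nonneg_prod p)]
    exact (norm_le_pi_norm p.1 σ).trans (le_add_of_nonneg_right (norm_nonneg _))
  have i2 : ∀ σ j, Integrable (fun p : (SpinConfig N → ℝ) × Mat N k => (∑ i, p.2 i j * spin σ i) *
      totalWeight (matLaw ξ N q) m (ham (Real.sin s) (Real.cos s) p.1) σ p.2)
      (γ.prod (matLaw ξ N q)) := fun σ j => by
    have hmeas : Measurable fun p : (SpinConfig N → ℝ) × Mat N k => ∑ i, p.2 i j * spin σ i := by
      fun_prop
    refine hM.integrable_prod hγe (ExpGrowth.mul (LinGrowth.expGrowth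
      (LinGrowth.sum hK.nonneg_prod fun i _ => ?_)) (hT σ)) (hmeas.mul (hTm σ))
    refine (LinGrowth.self hK.nonneg_prod).of_le fun p => ?_
    rw [abs_of_nonneg (hK.nonneg_prod p), abs_mul, abs_spin, mul_one]
    exact ((norm_le_pi_norm (p.2 i) j).trans (norm_le_pi_norm p.2 i)).trans
      (le_add_of_nonneg_left (norm_nonneg _))
  -- The velocity is `cos s` times the field minus `sin s` times the columns. Integration by parts
  -- supplies a factor `sin s` for the field and `cos s` for the columns, so `sin s cos s` is common
  -- to both contributions.
  have hmain : ∀ σ, ∫ p : (SpinConfig N → ℝ) × Mat N k, totalWeight (matLaw ξ N q) m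
      (ham (Real.sin s) (Real.cos s) p.1) σ p.2 * ham (Real.cos s) (-Real.sin s) p.1 σ p.2
        ∂(γ.prod (matLaw ξ N q)) =
      N * (Real.sin s * Real.cos s) * ((ξ 1 - deriv ξ 1) * A σ - ∑ r : Fin k,
        (m r.succ - m r.castSucc) * ∑ τ, (ξ (overlap σ τ) -
          overlap σ τ * deriv ξ (q r.succ.castSucc)) * G r σ τ) := fun σ => by
    have e : ∀ p : (SpinConfig N → ℝ) × Mat N k, totalWeight (matLaw ξ N q) m
        (ham (Real.sin s) (Real.cos s) p.1) σ p.2 * ham (Real.cos s) (-Real.sin s) p.1 σ p.2 =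
        Real.cos s * (p.1 σ * totalWeight (matLaw ξ N q) m
          (ham (Real.sin s) (Real.cos s) p.1) σ p.2) + (-Real.sin s) * ∑ j,
          (∑ i, p.2 i j * spin σ i) * totalWeight (matLaw ξ N q) m
          (ham (Real.sin s) (Real.cos s) p.1) σ p.2 := fun p => by
      rw [← Finset.sum_mul, Finset.sum_comm]
      simp only [← Finset.sum_mul]
      rw [ham]
      ring
    simp only [e]
    rw [integral_add ((i1 σ).const_mul _)
      ((integrable_finsetSum _ fun j _ => i2 σ j).const_mul _), integral_const_mul,
      integral_const_mul, integral_finsetSum _ fun j _ => i2 σ j, hfield]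
    simp only [hcol, Finset.sum_sub_distrib]
    rw [← Finset.sum_mul, hdq, Finset.sum_comm]
    simp only [← Finset.mul_sum, ← Finset.sum_mul, hdq', overlap_self hN]
    change Real.cos s * (Real.sin s * (N * ξ 1) * A σ - ∑ r : Fin k, (m r.succ - m r.castSucc) *
      ∑ τ, Real.sin s * (N * ξ (overlap σ τ)) * G r σ τ) + -Real.sin s * (deriv ξ 1 *
      (Real.cos s * N * A σ) - ∑ r : Fin k, (m r.succ - m r.castSucc) *
        (deriv ξ (q r.succ.castSucc) * ∑ τ, Real.cos s * N * overlap σ τ * G r σ τ)) = _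
    have h1 : ∑ r : Fin k, (m r.succ - m r.castSucc) * ∑ τ, (ξ (overlap σ τ) -
        overlap σ τ * deriv ξ (q r.succ.castSucc)) * G r σ τ =
        ∑ r : Fin k, (m r.succ - m r.castSucc) * (∑ τ, ξ (overlap σ τ) * G r σ τ) -
        ∑ r : Fin k, (m r.succ - m r.castSucc) * (deriv ξ (q r.succ.castSucc) *
          ∑ τ, overlap σ τ * G r σ τ) := by
      rw [← Finset.sum_sub_distrib]
      refine Finset.sum_congr rfl fun r _ => ?_
      rw [← mul_sub, Finset.mul_sum (a := deriv ξ _), ← Finset.sum_sub_distrib]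
      congr 1
      exact Finset.sum_congr rfl fun τ _ => by ring
    have h2 : ∀ r : Fin k, ∑ τ, Real.sin s * (N * ξ (overlap σ τ)) * G r σ τ =
        Real.sin s * N * ∑ τ, ξ (overlap σ τ) * G r σ τ := fun r => by
      rw [Finset.mul_sum]
      exact Finset.sum_congr rfl fun τ _ => by ring
    have h3 : ∀ r : Fin k, ∑ τ, Real.cos s * N * overlap σ τ * G r σ τ =
        Real.cos s * N * ∑ τ, overlap σ τ * G r σ τ := fun r => by
      rw [Finset.mul_sum]
      exact Finset.sum_congr rfl fun τ _ => by ring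
    simp only [h1, h2, h3, mul_left_comm _ (Real.sin s * (N : ℝ)),
      mul_left_comm _ (Real.cos s * (N : ℝ)), ← Finset.mul_sum]
    ring
  -- Here `-θ(1) = ξ(1) - ξ'(1)`, and since the pair weights have total mass one, the constant
  -- `θ(q_r)` inside `Δ` cancels the separate sum of the `θ(q_r)`.
  have hsum : derivFormula γ ξ m q s = (1 / 2) * ((ξ 1 - deriv ξ 1) - ∑ r : Fin k,
      (m r.succ - m r.castSucc) * ∑ σ, ∑ τ, (ξ (overlap σ τ) -
        overlap σ τ * deriv ξ (q r.succ.castSucc)) * G r σ τ) := by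
    have hr : ∀ r : Fin k, ∑ σ, ∑ τ, Delta ξ (overlap σ τ) (q r.succ.castSucc) * G r σ τ =
        ∑ σ, ∑ τ, (ξ (overlap σ τ) - overlap σ τ * deriv ξ (q r.succ.castSucc)) * G r σ τ +
          theta ξ (q r.succ.castSucc) := fun r => by
      simp only [Delta, add_mul, Finset.sum_add_distrib, ← Finset.mul_sum, hG1, hA1, mul_one]
    have : derivFormula γ ξ m q s = -(1 / 2) * theta ξ 1 + (1 / 2) * ∑ r : Fin k,
        (m r.succ - m r.castSucc) * theta ξ (q r.succ.castSucc)
        - (1 / 2) * ∑ r : Fin k, (m r.succ - m r.castSucc) * ∑ σ, ∑ τ,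
        Delta ξ (overlap σ τ) (q r.succ.castSucc) * G r σ τ := rfl
    rw [this]
    simp only [hr, mul_add, Finset.sum_add_distrib, theta]
    ring
  change ∑ σ, ∫ p : (SpinConfig N → ℝ) × Mat N k, totalWeight (matLaw ξ N q) m
      (ham (Real.sin s) (Real.cos s) p.1) σ p.2 * ham (Real.cos s) (-Real.sin s) p.1 σ p.2
        ∂(γ.prod (matLaw ξ N q)) = _
  simp only [hmain, ← Finset.mul_sum, Finset.sum_sub_distrib, hA1]
  rw [hsum, Finset.sum_comm]
  simp only [← Finset.mul_sum]
  ring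

end Interpolation

end Guerra

end

/-! ### Return to the probability space `Ω` and to the variable `t`. -/

noncomputable section

namespace Guerra

section Transfer

variable {Ω α β : Type*} [MeasurableSpace Ω] [MeasurableSpace α] [MeasurableSpace β]
  {P : Measure Ω} [SFinite P] {ν : Measure β} [SFinite ν] {H : Ω → α}

omit [SFinite P] [SFinite ν] in
lemma aemeasurable_prodMap_left (hH : AEMeasurable H P) :
    AEMeasurable (fun x : Ω × β => (H x.1, x.2)) (P.prod ν) :=
  (hH.comp_quasiMeasurePreserving Measure.quasiMeasurePreserving_fst).prodMk
    measurable_snd.aemeasurable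

/-- `H` is only almost everywhere measurable, so the product formula for image measures is applied
to a measurable modification. -/
lemma map_prodMap_left (hH : AEMeasurable H P) :
    (P.prod ν).map (fun x : Ω × β => (H x.1, x.2)) = (P.map H).prod ν := by
  have e : (fun x : Ω × β => (H x.1, x.2)) =ᵐ[P.prod ν] fun x => (hH.mk H x.1, x.2) := by
    filter_upwards [Measure.quasiMeasurePreserving_fst.ae hH.ae_eq_mk] with x hx
    simp only [hx]
  have h := Measure.map_prod_map P ν hH.measurable_mk measurable_id
  rw [Measure.map_congr e, Measure.map_congr hH.ae_eq_mk]
  simpa [Prod.map_def] using h.symm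

end Transfer

section Final

variable {N k : ℕ} {m : Fin (k + 1) → ℝ} {ξ : ℝ → ℝ} {q : Fin (k + 2) → ℝ}
  {Ω : Type*} [MeasurableSpace Ω] {P : Measure Ω} [IsProbabilityMeasure P]
  {H : Ω → SpinConfig N → ℝ}

lemma integrable_X (hH : AEMeasurable H P) [IsGaussian (P.map H)] (hm : ∀ l : Fin k, 0 < m l.succ)
    (t : ℝ) (l : Fin (k + 1)) :
    Integrable (fun x : Ω × Mat N k => X ξ m q t (H x.1) l x.2) (P.prod (matLaw ξ N q)) := by
  have hM := spliceInvariant_matLaw ξ N q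
  have hK := admissible_ham_const (N := N) (k := k) (√t) (√(1 - t))
  have h : Integrable (fun p : (SpinConfig N → ℝ) × Mat N k => nested (matLaw ξ N q) m
      (ham (√t) (√(1 - t)) p.1) l p.2) ((P.map H).prod (matLaw ξ N q)) :=
    hM.integrable_prod (expMoments_norm (P.map H)) (hK.linGrowth_nested hM hm l).expGrowth
      (hK.measurable_nested l)
  rw [← map_prodMap_left hH] at h
  exact (integrable_map_measure h.aestronglyMeasurable (aemeasurable_prodMap_left hH)).1 h

lemma integrable_muIntegrand_and_mu_eq (hH : AEMeasurable H P) [IsGaussian (P.map H)]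
    (hm : ∀ l : Fin k, 0 < m l.succ) (hm_zero : m 0 = 0) (hm_last : m (Fin.last k) = 1)
    (t : ℝ) (r : Fin k) (f : SpinConfig N → SpinConfig N → ℝ) :
    Integrable (fun x : Ω × Mat N k × Mat N k =>
        muIntegrand ξ m q t r f (H x.1) x.2.1 (splice r.succ x.2.1 x.2.2))
        (P.prod ((matLaw ξ N q).prod (matLaw ξ N q))) ∧
      mu P ξ H m q t r f = ∑ σ, ∑ τ, f σ τ *
        pairWeight (P.map H) (matLaw ξ N q) m (ham (√t) (√(1 - t))) r σ τ := by
  have hM := spliceInvariant_matLaw ξ N q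
  have hK := admissible_ham_const (N := N) (k := k) (√t) (√(1 - t))
  have hpair := fun σ τ => hK.integrable_pair hM (expMoments_norm (P.map H)) hm r σ τ
  have hin : ∀ σ, Integrable (fun x : (SpinConfig N → ℝ) × Mat N k × Mat N k => ∑ τ, f σ τ *
      (totalWeight (matLaw ξ N q) m (ham (√t) (√(1 - t)) x.1) σ x.2.1 *
        tailWeight (matLaw ξ N q) m (ham (√t) (√(1 - t)) x.1) r τ (splice r.succ x.2.1 x.2.2)))
      ((P.map H).prod ((matLaw ξ N q).prod (matLaw ξ N q))) := fun σ =>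
    integrable_finsetSum _ fun τ _ => (hpair σ τ).const_mul _
  have h : Integrable (fun x : (SpinConfig N → ℝ) × Mat N k × Mat N k =>
      muIntegrand ξ m q t r f x.1 x.2.1 (splice r.succ x.2.1 x.2.2))
      ((P.map H).prod ((matLaw ξ N q).prod (matLaw ξ N q))) := by
    simp only [muIntegrand_eq hm_zero hm_last]
    exact integrable_finsetSum _ fun σ _ => hin σ
  have hval : ∫ x : (SpinConfig N → ℝ) × Mat N k × Mat N k,
      muIntegrand ξ m q t r f x.1 x.2.1 (splice r.succ x.2.1 x.2.2)
        ∂((P.map H).prod ((matLaw ξ N q).prod (matLaw ξ N q))) = ∑ σ, ∑ τ, f σ τ *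
        pairWeight (P.map H) (matLaw ξ N q) m (ham (√t) (√(1 - t))) r σ τ := by
    simp only [muIntegrand_eq hm_zero hm_last]
    rw [integral_finsetSum _ fun σ _ => hin σ]
    refine Finset.sum_congr rfl fun σ _ => ?_
    rw [integral_finsetSum _ fun τ _ => (hpair σ τ).const_mul _]
    simp only [integral_const_mul, pairWeight]
  rw [← map_prodMap_left hH] at h hval
  refine ⟨(integrable_map_measure h.aestronglyMeasurable (aemeasurable_prodMap_left hH)).1 h, ?_⟩
  rw [integral_map (aemeasurable_prodMap_left hH) h.aestronglyMeasurable] at hval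
  exact hval

lemma phi_eq (hH : AEMeasurable H P) [IsGaussian (P.map H)] (t : ℝ) : phi P ξ H m q t = (N : ℝ)⁻¹ * ∫ p : (SpinConfig N → ℝ) × Mat N k,
      nested (matLaw ξ N q) m (ham (√t) (√(1 - t)) p.1) 0 p.2
        ∂((P.map H).prod (matLaw ξ N q)) := by
  have hK := admissible_ham_const (N := N) (k := k) (√t) (√(1 - t))
  rw [phi, ← map_prodMap_left hH, integral_map (aemeasurable_prodMap_left hH)
    (hK.measurable_nested 0).aestronglyMeasurable]
  rfl

lemma sin_arcsin_sqrt {t : ℝ} (ht : t ∈ Set.Icc (0 : ℝ) 1) : Real.sin (Real.arcsin (√t)) = √t :=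
  Real.sin_arcsin (by linarith [Real.sqrt_nonneg t]) (Real.sqrt_le_one.2 ht.2)

lemma cos_arcsin_sqrt {t : ℝ} (ht : t ∈ Set.Icc (0 : ℝ) 1) :
    Real.cos (Real.arcsin (√t)) = √(1 - t) := by
  rw [Real.cos_arcsin, Real.sq_sqrt ht.1]

lemma hasDerivAt_arcsin_sqrt {t : ℝ} (ht : t ∈ Set.Ioo (0 : ℝ) 1) :
    HasDerivAt (fun t => Real.arcsin (√t)) (2 * √t * √(1 - t))⁻¹ t := by
  have h1 : √t < 1 := by rw [Real.sqrt_lt' one_pos]; simpa using ht.2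
  have h := (Real.hasDerivAt_arcsin (by linarith [Real.sqrt_nonneg t]) h1.ne).comp t
    (Real.hasDerivAt_sqrt ht.1.ne')
  refine h.congr_deriv ?_
  rw [Real.sq_sqrt ht.1.le]
  simp only [one_div]
  rw [← mul_inv]
  ring_nf

/-- On the open interval the factor `2 sin s cos s` of the angular derivative is the reciprocal of
the derivative of `arcsin √t`. The latter blows up at the endpoints, where continuity of both sides
takes over. -/
lemma hasDerivWithinAt_phi (hN : 1 ≤ N) (hk : 1 ≤ k) (hH : AEMeasurable H P) [IsGaussian (P.map H)]
    (hmean : ∀ σ, ∫ h, h σ ∂(P.map H) = 0)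
    (hcov : ∀ σ τ, ∫ h, h σ * h τ ∂(P.map H) = N * ξ (overlap σ τ))
    (hq : ∀ l : Fin (k + 1), deriv ξ (q l.castSucc) ≤ deriv ξ (q l.succ))
    (hξ : deriv ξ 0 = 0) (hq_zero : q 0 = 0) (hq_last : q (Fin.last (k + 1)) = 1)
    (hm : ∀ l : Fin k, 0 < m l.succ) (hm_zero : m 0 = 0) (hm_last : m (Fin.last k) = 1)
    {t : ℝ} (ht : t ∈ Set.Icc (0 : ℝ) 1) :
    HasDerivWithinAt (phi P ξ H m q) (derivFormula (P.map H) ξ m q (Real.arcsin (√t)))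
      (Set.Icc 0 1) t := by
  have hN' : (N : ℝ) ≠ 0 := by positivity
  set ψ : ℝ → ℝ := fun s => ∫ p : (SpinConfig N → ℝ) × Mat N k, nested (matLaw ξ N q) m
    (ham (Real.sin s) (Real.cos s) p.1) 0 p.2 ∂((P.map H).prod (matLaw ξ N q)) with hψ
  have hψd : ∀ s, HasDerivAt ψ (N * (2 * Real.sin s * Real.cos s *
      derivFormula (P.map H) ξ m q s)) s := fun s =>
    hasDerivAt_rotation_integral hN hk hmean hcov hq hξ hq_zero hq_last hm hm_zero hm_last s
  have hψc : Continuous ψ := continuous_iff_continuousAt.2 fun s => (hψd s).continuousAt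
  have hsc : Continuous fun t : ℝ => Real.arcsin (√t) :=
    Real.continuous_arcsin.comp Real.continuous_sqrt
  have key := hasDerivWithinAt_Icc_of_continuous (f := fun t => (N : ℝ)⁻¹ * ψ (Real.arcsin (√t)))
    (f' := fun t => derivFormula (P.map H) ξ m q (Real.arcsin (√t)))
    (continuous_const.mul (hψc.comp hsc)) ((continuous_derivFormula hm).comp hsc)
    (fun t ht => ?_) ht
  · refine key.congr (fun t ht => ?_) ?_
    · simp only [phi_eq hH, hψ, sin_arcsin_sqrt ht, cos_arcsin_sqrt ht]
    · simp only [phi_eq hH, hψ, sin_arcsin_sqrt ht, cos_arcsin_sqrt ht]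
  · have ht' : t ∈ Set.Icc (0 : ℝ) 1 := Set.Ioo_subset_Icc_self ht
    refine (((hψd (Real.arcsin (√t))).comp t (hasDerivAt_arcsin_sqrt ht)).const_mul
      (N : ℝ)⁻¹).congr_deriv ?_
    rw [sin_arcsin_sqrt ht', cos_arcsin_sqrt ht']
    have h1 : √t ≠ 0 := (Real.sqrt_pos.2 ht.1).ne'
    have h2 : √(1 - t) ≠ 0 := (Real.sqrt_pos.2 (by linarith [ht.2])).ne'
    field_simp

end Final

end Guerra

end

theorem mainTheorem10 {Ω : Type*} [MeasurableSpace Ω] (P : Measure Ω) [IsProbabilityMeasure P]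
    (ξ : ℝ → ℝ) (hξ_smooth : ContDiff ℝ ((⊤ : ℕ∞) : WithTop ℕ∞) ξ)
    (hξ_convex : ConvexOn ℝ Set.univ ξ) (hξ_zero : ξ 0 = 0) (hξ_deriv_zero : deriv ξ 0 = 0)
    (N : ℕ) (hN : 1 ≤ N) (H : Ω → Guerra.SpinConfig N → ℝ) (hH : Guerra.IsHamiltonian P ξ H)
    (k : ℕ) (hk : 1 ≤ k)
    (m : Fin (k + 1) → ℝ) (hm : StrictMono m) (hm_zero : m 0 = 0) (hm_last : m (Fin.last k) = 1)
    (q : Fin (k + 2) → ℝ) (hq : StrictMono q) (hq_zero : q 0 = 0)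
    (hq_last : q (Fin.last (k + 1)) = 1)
    (t : ℝ) (ht : t ∈ Set.Icc (0 : ℝ) 1) :
    -- all the expectations in the definitions of `X_l`, `φ(t)` and `μ_r(f)` are well defined
    (∀ (h : Guerra.SpinConfig N → ℝ) (l : Fin k) (z : Guerra.Mat N k),
      Integrable (fun z' => Real.exp (m l.succ *
        Guerra.X ξ m q t h l.succ (Guerra.splice l.succ z z'))) (Guerra.matLaw ξ N q)) ∧
    Integrable (fun x : Ω × Guerra.Mat N k => Guerra.X ξ m q t (H x.1) 0 x.2)
      (P.prod (Guerra.matLaw ξ N q)) ∧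
    (∀ (r : Fin k) (f : Guerra.SpinConfig N → Guerra.SpinConfig N → ℝ),
      Integrable (fun x : Ω × Guerra.Mat N k × Guerra.Mat N k =>
        Guerra.muIntegrand ξ m q t r f (H x.1) x.2.1 (Guerra.splice r.succ x.2.1 x.2.2))
        (P.prod ((Guerra.matLaw ξ N q).prod (Guerra.matLaw ξ N q)))) ∧
    -- the derivative of `φ` on `[0, 1]` (one-sided at the endpoints)
    HasDerivWithinAt (Guerra.phi P ξ H m q)
      (-(1 / 2) * Guerra.theta ξ 1
        + (1 / 2) * ∑ r : Fin k,
            (m r.succ - m r.castSucc) * Guerra.theta ξ (q r.succ.castSucc)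
        - (1 / 2) * ∑ r : Fin k, (m r.succ - m r.castSucc) *
            Guerra.mu P ξ H m q t r
              (fun σ τ => Guerra.Delta ξ (Guerra.overlap σ τ) (q r.succ.castSucc)))
      (Set.Icc 0 1) t := by
  have hHm : AEMeasurable H P := hH.gaussian.aemeasurable
  have : IsGaussian (P.map H) := hH.gaussian.isGaussian_map
  have hm_pos : ∀ l : Fin k, 0 < m l.succ := fun l => hm_zero ▸ hm (Fin.succ_pos l)
  -- Convexity enters through the variances `ξ'(q_{l+1}) - ξ'(q_l)`, which it makes nonnegative.
  have hmono : Monotone (deriv ξ) := monotoneOn_univ.1 (hξ_convex.monotoneOn_deriv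
    fun x _ => hξ_smooth.differentiable (by simp) x)
  have hmean : ∀ σ, ∫ h, h σ ∂(P.map H) = 0 := fun σ => by
    rw [integral_map hHm (measurable_pi_apply σ).aestronglyMeasurable]
    exact hH.mean σ
  have hcov : ∀ σ τ, ∫ h, h σ * h τ ∂(P.map H) = N * ξ (Guerra.overlap σ τ) := fun σ τ => by
    rw [integral_map hHm (by fun_prop)]
    exact hH.cov σ τ
  refine ⟨fun h l z => ?_, Guerra.integrable_X hHm hm_pos t 0, fun r f =>
    (Guerra.integrable_muIntegrand_and_mu_eq hHm hm_pos hm_zero hm_last t r f).1, ?_⟩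
  · exact (Guerra.admissible_ham_const (√t) (√(1 - t))).integrable_exp_nested
      (Guerra.spliceInvariant_matLaw ξ N q) hm_pos l h z
  · have hphi := Guerra.hasDerivWithinAt_phi hN hk hHm hmean hcov
      (fun l => hmono (hq Fin.castSucc_lt_succ).le) hξ_deriv_zero hq_zero hq_last hm_pos hm_zero
      hm_last ht
    rw [Guerra.derivFormula, Guerra.sin_arcsin_sqrt ht, Guerra.cos_arcsin_sqrt ht] at hphi
    simpa only [(Guerra.integrable_muIntegrand_and_mu_eq hHm hm_pos hm_zero hm_last t _ _).2]
      using hphi
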